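/- Let $\mu>0$, $x\ge 0$ and $y>x+1$ be real. The generalized Marcum function is $$Q_\mu(a,b)=a^{\frac12(1-\mu)}\int_b^{\infty}t^{\frac12(\mu-1)}e^{-t-a}I_{\mu-1}(2\sqrt{at})\,dt\qquad(a\ge0,\ b\ge 0),$$ where $I_\nu$ is the modified Bessel function of the first kind and the case $a=0$ is understood as the limit of the integrand for $a\to0^+$, i.e. $Q_\mu(0,b)=\frac1{\Gamma(\mu)}\int_b^\infty t^{\mu-1}e^{-t}\,dt$. Put $$\xi=2\sqrt{xy},\qquad \phi(s)=\frac xs+ys-\ln s,\qquad s_0=\frac{1+\sqrt{1+\xi^2}}{2y},$$ with the principal branch of $\ln$, and, for $-\pi<\theta<\pi$ (with $\theta/\sin\theta:=1$ at $\theta=0$), $$\rho(\theta,\xi)=\sqrt{\Big(\frac{\theta}{\sin\theta}\Big)^2+\xi^2},\qquad r(\theta)=\frac1{2y}\Big(\frac{\theta}{\sin\theta}+\rho(\theta,\xi)\Big),$$ $$f(\theta)=\frac{\sin\theta\,r'(\theta)+(\cos\theta-r(\theta))\,r(\theta)}{r(\theta)^2-2r(\theta)\cos\theta+1},$$ $$\psi(\theta)=\cos\theta\,\rho(\theta,\xi)-\sqrt{1+\xi^2}-\ln\frac{\frac{\theta}{\sin\theta}+\rho(\theta,\xi)}{1+\sqrt{1+\xi^2}}.$$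 Then: 1. $0<s_0<1$ and $\phi'(s_0)=0$. The contour $s=r(\theta)e^{i\theta}$, $-\pi<\theta<\pi$, satisfies $r(\theta)>0$, passes through $s_0$ at $\theta=0$, and on it $\phi$ is real: $\phi(r(\theta)e^{i\theta})=\cos\theta\,\rho(\theta,\xi)-\ln r(\theta)$. 2. $r$ is differentiable on $(-\pi,\pi)$, $r'(\theta)=\dfrac{\sin\theta-\theta\cos\theta}{2y\sin^2\theta}\Big(1+\dfrac{\theta}{\rho(\theta,\xi)\sin\theta}\Big)$ for $\theta\ne0$, and $f$ is even. 3. There is a real $\zeta$ with $-x-y+\phi(s_0)=-\tfrac12\zeta^2$, and for each such $\zeta$ $$Q_\mu(\mu x,\mu y)=\frac{e^{-\frac12\mu\zeta^2}}{2\pi}\int_{-\pi}^{\pi}e^{\mu\psi(\theta)}f(\theta)\,d\theta .$$ The integral here and the integral defining $Q_\mu(\mu x,\mu y)$ converge absolutely. -/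

import Mathlib

noncomputable section

namespace Marcum

/-- Modified Bessel function of the first kind `I_ν(z)` for real order `ν` and real `z > 0`. -/
def besselI (ν z : ℝ) : ℝ :=
  (z / 2) ^ ν * ∑' n : ℕ, (z / 2) ^ (2 * n) / ((n.factorial : ℝ) * Real.Gamma (ν + n + 1))

/-- Integrand of the generalized Marcum function, `t > 0`.  At `x = 0` the product
`x^((1-μ)/2) I_{μ-1}(2√(xt))` is understood as its limit `t^((μ-1)/2) / Γ(μ)` for `x → 0+`. -/
def integrand (μ x t : ℝ) : ℝ :=
  if x = 0 then t ^ (μ - 1) * Real.exp (-t) / Real.Gamma μ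
  else x ^ ((1 - μ) / 2) *
    (t ^ ((μ - 1) / 2) * Real.exp (-t - x) * besselI (μ - 1) (2 * √(x * t)))

/-- The generalized Marcum function `Q_μ(x, y)`. -/
def Q (μ x y : ℝ) : ℝ := ∫ t in Set.Ioi y, integrand μ x t

/-- The phase function `φ(s) = x / s + y s - ln s`, with the principal logarithm. -/
def phi (x y : ℝ) (s : ℂ) : ℂ := x / s + y * s - Complex.log s

def xi (x y : ℝ) : ℝ := 2 * √(x * y)

/-- The saddle point of `phi x y`. -/
def s₀ (x y : ℝ) : ℝ := (1 + √(1 + xi x y ^ 2)) / (2 * y)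

/-- `θ / sin θ`, with its limit value `1` at `θ = 0`. -/
def tau (θ : ℝ) : ℝ := if θ = 0 then 1 else θ / Real.sin θ

def rho (θ ξ : ℝ) : ℝ := √(tau θ ^ 2 + ξ ^ 2)

/-- Polar radius of the contour. -/
def r (x y θ : ℝ) : ℝ := (tau θ + rho θ (xi x y)) / (2 * y)

def f (x y θ : ℝ) : ℝ :=
  (Real.sin θ * deriv (r x y) θ + (Real.cos θ - r x y θ) * r x y θ) /
    (r x y θ ^ 2 - 2 * r x y θ * Real.cos θ + 1)

def psi (x y θ : ℝ) : ℝ :=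
  Real.cos θ * rho θ (xi x y) - √(1 + xi x y ^ 2)
    - Real.log ((tau θ + rho θ (xi x y)) / (1 + √(1 + xi x y ^ 2)))

end Marcum

end

open Real Set Filter Topology MeasureTheory

namespace Marcum

/-! ### The function `θ / sin θ` -/

/-! Write `X = μx`, `Y = μy`. Expanding the Bessel function turns the Marcum integrand into
`e^(-t-X) t^(μ-1) ∑ (Xt)^n / (n! Γ(μ+n))`. Hankel's integral for each `1/Γ(μ+n)`, taken along the
contour `s = r(θ)e^{iθ}` scaled by `t`, sums to `e^(-t-X)/(2πi) ∫ e^(X/s+ts) s^(-μ) ds`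
(`integral_weight`). On the contour `Re s ≤ s₀ < 1`, so Fubini applies and the integral over `t > Y`
contributes `1/(1-s)` (`Q_eq_integral`). The exponents then collect to `μ(-x-y+φ(s))`.

The radius solves `y r - x/r = θ / sin θ`, which is the vanishing of `Im φ` (`phi_contour`). So
`e^(μφ)` is real, and as `Q` is real, only `Re (ds / (i(1-s)))`, which is `f dθ`, survives
(`f_eq_re`). Factoring out the value at `s₀` leaves `ψ` and `ζ`.

No contour is deformed: Hankel's formula is proved along every admissible polar curve
(`IsHankelRadius.hankel`), by an explicit primitive for `0 < a < 1`, continuity at `a = 1`, and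
integration by parts beyond. The estimates on `tau` supply the decay: `Re s` falls at least like
`-tau / y` while the speed grows at most like `tau ^ 2`. -/

lemma tau_zero : tau 0 = 1 := if_pos rfl

lemma tau_of_ne {θ : ℝ} (h : θ ≠ 0) : tau θ = θ / sin θ := if_neg h

lemma tau_neg (θ : ℝ) : tau (-θ) = tau θ := by
  simp [tau]

lemma sin_ne_zero_of_mem_Ioo {θ : ℝ} (h : θ ∈ Ioo (-π) π) (h0 : θ ≠ 0) : sin θ ≠ 0 := by
  rcases lt_or_gt_of_ne h0 with h1 | h1
  · exact (sin_neg_of_neg_of_neg_pi_lt h1 h.1).ne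
  · exact (sin_pos_of_pos_of_lt_pi h1 h.2).ne'

lemma sin_mul_tau {θ : ℝ} (h : θ ∈ Ioo (-π) π) : sin θ * tau θ = θ := by
  by_cases h0 : θ = 0
  · simp [h0]
  · rw [tau_of_ne h0, mul_div_cancel₀ _ (sin_ne_zero_of_mem_Ioo h h0)]

/-- An even property of the points of `(-π, π)` may be checked on `[0, π)`. -/
lemma forall_Ioo_of_even {P : ℝ → Prop} (hP : ∀ θ, P θ → P (-θ)) (h0 : P 0)
    (h : ∀ θ, 0 < θ → θ < π → P θ) {θ : ℝ} (hθ : θ ∈ Ioo (-π) π) : P θ := by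
  rcases lt_trichotomy θ 0 with h1 | rfl | h1
  · simpa using hP _ (h (-θ) (by linarith) (by linarith [hθ.1]))
  · exact h0
  · exact h θ h1 hθ.2

lemma one_le_tau {θ : ℝ} (hθ : θ ∈ Ioo (-π) π) : 1 ≤ tau θ := by
  refine forall_Ioo_of_even (P := fun θ => 1 ≤ tau θ) (by simp [tau_neg]) (by simp [tau_zero])
    (fun θ h1 h2 => ?_) hθ
  rw [tau_of_ne h1.ne', one_le_div (sin_pos_of_pos_of_lt_pi h1 h2)]
  exact sin_le h1.le

lemma tau_mul_cos_le_one {θ : ℝ} (hθ : θ ∈ Ioo (-π) π) : tau θ * cos θ ≤ 1 := by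
  refine forall_Ioo_of_even (P := fun θ => tau θ * cos θ ≤ 1) (by simp [tau_neg])
    (by simp [tau_zero]) (fun θ h1 h2 => ?_) hθ
  have hs := sin_pos_of_pos_of_lt_pi h1 h2
  rw [tau_of_ne h1.ne', div_mul_eq_mul_div, div_le_one hs]
  rcases lt_or_ge θ (π / 2) with h3 | h3
  · have hc := cos_pos_of_mem_Ioo ⟨by linarith, h3⟩
    have := le_tan h1.le h3
    rwa [tan_eq_sin_div_cos, le_div_iff₀ hc] at this
  · have := cos_nonpos_of_pi_div_two_le_of_le h3 (by linarith)
    nlinarith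

/-- The half-angle formulas give `tau θ * (1 + cos θ) = 2 * tau (θ/2) * cos (θ/2)`, which reduces
this to `tau_mul_cos_le_one`. -/
lemma tau_mul_one_add_cos_le {θ : ℝ} (hθ : θ ∈ Ioo (-π) π) : tau θ * (1 + cos θ) ≤ 2 := by
  refine forall_Ioo_of_even (P := fun θ => tau θ * (1 + cos θ) ≤ 2) (by simp [tau_neg])
    (by simp [tau_zero]; norm_num) (fun θ h1 h2 => ?_) hθ
  have ha : 0 < θ / 2 := by linarith
  have hs := sin_pos_of_pos_of_lt_pi ha (by linarith)
  have hc := cos_pos_of_mem_Ioo (x := θ / 2) ⟨by linarith, by linarith⟩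
  have key := tau_mul_cos_le_one (θ := θ / 2) ⟨by linarith, by linarith⟩
  have e1 : sin θ = 2 * sin (θ / 2) * cos (θ / 2) := by rw [← sin_two_mul]; ring_nf
  have e2 : cos θ = 2 * cos (θ / 2) ^ 2 - 1 := by rw [← cos_two_mul]; ring_nf
  rw [tau_of_ne h1.ne', e1, e2]
  rw [tau_of_ne ha.ne'] at key
  calc θ / (2 * sin (θ / 2) * cos (θ / 2)) * (1 + (2 * cos (θ / 2) ^ 2 - 1))
      = 2 * (θ / 2 / sin (θ / 2) * cos (θ / 2)) := by field_simp; ring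
    _ ≤ 2 := by linarith

lemma tau_mul_cos_le {θ : ℝ} (hθ : θ ∈ Ioo (-π) π) : tau θ * cos θ ≤ 2 - tau θ := by
  linarith [tau_mul_one_add_cos_le hθ]

/-- The derivative of `tau`; the quotient is `0 / 0 = 0` at the origin, as it should be. -/
noncomputable def dtau (θ : ℝ) : ℝ := (sin θ - θ * cos θ) / sin θ ^ 2

lemma hasDerivAt_tau {θ : ℝ} (hθ : θ ∈ Ioo (-π) π) : HasDerivAt tau (dtau θ) θ := by
  by_cases h0 : θ = 0
  · subst h0
    -- Near the origin `1 ≤ tau ≤ 1 / cos`, and both bounds have value `1` and slope `0` there.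
    have hd : HasDerivAt (fun t : ℝ => (cos t)⁻¹) 0 0 := by
      simpa using (hasDerivAt_cos 0).fun_inv (by simp)
    rw [show dtau 0 = 0 by simp [dtau]]
    rw [hasDerivAt_iff_isLittleO] at hd ⊢
    refine Asymptotics.IsBigO.trans_isLittleO (Asymptotics.IsBigO.of_bound 1 ?_) hd
    filter_upwards [Ioo_mem_nhds (neg_lt_zero.2 pi_div_two_pos) pi_div_two_pos] with t ht
    have ht' : t ∈ Ioo (-π) π := ⟨by linarith [ht.1, pi_pos], by linarith [ht.2, pi_pos]⟩
    have hc := cos_pos_of_mem_Ioo ht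
    have h1 := one_le_tau ht'
    have h2 := tau_mul_cos_le_one ht'
    rw [← le_div_iff₀ hc, one_div] at h2
    simp only [tau_zero, smul_zero, sub_zero, cos_zero, inv_one, norm_eq_abs, one_mul]
    rw [abs_of_nonneg (by linarith), abs_of_nonneg (by linarith)]
    linarith
  · have hs := sin_ne_zero_of_mem_Ioo hθ h0
    have := ((hasDerivAt_id θ).fun_div (hasDerivAt_sin θ) hs)
    simp only [id, one_mul] at this
    refine this.congr_of_eventuallyEq ?_
    filter_upwards [isOpen_ne.mem_nhds h0] with t ht using tau_of_ne ht

lemma dtau_neg (θ : ℝ) : dtau (-θ) = -dtau θ := by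
  simp only [dtau, sin_neg, cos_neg]; ring

lemma abs_dtau_le {θ : ℝ} (hθ : θ ∈ Ioo (-π) π) : |dtau θ| ≤ tau θ ^ 2 := by
  refine forall_Ioo_of_even (P := fun θ => |dtau θ| ≤ tau θ ^ 2) (by simp [tau_neg, dtau_neg])
    (by simp [tau_zero, dtau]) (fun θ h1 h2 => ?_) hθ
  have hs := sin_pos_of_pos_of_lt_pi h1 h2
  rw [tau_of_ne h1.ne', dtau, abs_div, div_pow, abs_of_nonneg (sq_nonneg (sin θ))]
  gcongr
  have h3 := tau_mul_cos_le_one (θ := θ) ⟨by linarith, h2⟩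
  rw [tau_of_ne h1.ne', div_mul_eq_mul_div, div_le_one hs] at h3
  rw [abs_of_nonneg (by linarith)]
  have h4 := sin_le h1.le
  -- Since `sin θ ≤ θ`, the numerator of `dtau` is at most `θ (1 - cos θ)`, hence at most `θ ^ 2`.
  have h5 : 1 - cos θ ≤ θ := by
    rcases le_total θ 2 with h | h
    · nlinarith [one_sub_sq_div_two_le_cos (x := θ)]
    · linarith [neg_one_le_cos θ]
  nlinarith

lemma measurable_tau : Measurable tau :=
  Measurable.ite (measurableSet_singleton 0) measurable_const (by fun_prop)

lemma tendsto_tau_right : Tendsto tau (𝓝[<] π) atTop := by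
  have h1 : Tendsto sin (𝓝[<] π) (𝓝[>] 0) := by
    refine tendsto_nhdsWithin_iff.2 ⟨?_, ?_⟩
    · simpa using (continuous_sin.tendsto π).mono_left nhdsWithin_le_nhds
    · filter_upwards [Ioo_mem_nhdsLT pi_pos] with t ht using sin_pos_of_pos_of_lt_pi ht.1 ht.2
  have h2 : Tendsto (fun t : ℝ => t) (𝓝[<] π) (𝓝 π) := tendsto_nhdsWithin_of_tendsto_nhds tendsto_id
  refine (h2.pos_mul_atTop pi_pos h1.inv_tendsto_nhdsGT_zero).congr' ?_
  filter_upwards [Ioo_mem_nhdsLT pi_pos] with t ht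
  rw [tau_of_ne ht.1.ne', div_eq_mul_inv]; rfl

lemma tendsto_tau_left : Tendsto tau (𝓝[>] (-π)) atTop := by
  have := tendsto_tau_right.comp (tendsto_neg_nhdsGT_neg (a := π))
  exact this.congr fun t => tau_neg t

/-! ### The polar radius -/

section Radius

variable {x y : ℝ}

lemma rho_neg (θ ξ : ℝ) : rho (-θ) ξ = rho θ ξ := by simp [rho, tau_neg]

lemma r_neg (θ : ℝ) : r x y (-θ) = r x y θ := by simp [r, rho_neg, tau_neg]

lemma tau_le_rho {θ : ℝ} (ξ : ℝ) : tau θ ≤ rho θ ξ :=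
  le_sqrt_of_sq_le (by nlinarith [sq_nonneg ξ])

lemma rho_pos {θ : ℝ} (hθ : θ ∈ Ioo (-π) π) (ξ : ℝ) : 0 < rho θ ξ := by
  linarith [one_le_tau hθ, tau_le_rho (θ := θ) ξ]

lemma rho_sq (θ ξ : ℝ) : rho θ ξ ^ 2 = tau θ ^ 2 + ξ ^ 2 := sq_sqrt (by positivity)

lemma xi_sq (h : 0 ≤ x * y) : xi x y ^ 2 = 4 * (x * y) := by
  rw [xi, mul_pow, sq_sqrt h]; norm_num

lemma r_zero : r x y 0 = s₀ x y := by simp [r, s₀, rho, tau_zero]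

lemma s₀_pos (hy : 0 < y) : 0 < s₀ x y := by unfold s₀; positivity

lemma s₀_le_r (hy : 0 < y) {θ : ℝ} (hθ : θ ∈ Ioo (-π) π) : s₀ x y ≤ r x y θ := by
  have h := one_le_tau hθ
  unfold s₀ r rho
  gcongr
  nlinarith

lemma r_pos (hy : 0 < y) {θ : ℝ} (hθ : θ ∈ Ioo (-π) π) : 0 < r x y θ :=
  (s₀_pos hy).trans_le (s₀_le_r hy hθ)

/-- `r` is the positive root of `y r² - tau r - x = 0`. This equation is what makes `φ` real on the
contour, and at `θ = 0` it is the saddle point equation. -/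
lemma mul_r_sub_div_r (hx : 0 ≤ x) (hy : 0 < y) {θ : ℝ} (hθ : θ ∈ Ioo (-π) π) :
    y * r x y θ - x / r x y θ = tau θ := by
  have hr := r_pos (x := x) hy hθ
  have h1 := rho_sq θ (xi x y)
  rw [xi_sq (by positivity)] at h1
  have h2 : 2 * y * r x y θ = tau θ + rho θ (xi x y) := by unfold r; field_simp
  have h3 : y * r x y θ ^ 2 - tau θ * r x y θ - x = 0 := by
    have : 4 * y * (y * r x y θ ^ 2 - tau θ * r x y θ - x) = 0 := by
      have e : rho θ (xi x y) = 2 * y * r x y θ - tau θ := by linarith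
      rw [e] at h1
      linear_combination h1
    simpa [hy.ne'] using this
  field_simp
  linarith

lemma mul_r_add_div_r (hx : 0 ≤ x) (hy : 0 < y) {θ : ℝ} (hθ : θ ∈ Ioo (-π) π) :
    y * r x y θ + x / r x y θ = rho θ (xi x y) := by
  have h1 := mul_r_sub_div_r hx hy hθ
  have h2 : 2 * y * r x y θ = tau θ + rho θ (xi x y) := by unfold r; field_simp
  linarith

lemma cos_mul_rho_le {θ : ℝ} (hθ : θ ∈ Ioo (-π) π) {ξ : ℝ} (hc : 0 ≤ cos θ) :
    cos θ * rho θ ξ ≤ √(1 + ξ ^ 2) := by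
  refine le_sqrt_of_sq_le ?_
  rw [mul_pow, rho_sq]
  have h1 := tau_mul_cos_le_one hθ
  have h2 := mul_nonneg (zero_le_one.trans (one_le_tau hθ)) hc
  have h3 : cos θ ^ 2 ≤ 1 := cos_sq_le_one θ
  have h4 : (tau θ * cos θ) ^ 2 ≤ 1 := pow_le_one₀ h2 h1
  nlinarith [mul_nonneg (sub_nonneg.2 h3) (sq_nonneg ξ)]

/-- The contour stays to the left of the saddle point. -/
lemma r_mul_cos_le (hy : 0 < y) {θ : ℝ} (hθ : θ ∈ Ioo (-π) π) :
    r x y θ * cos θ ≤ s₀ x y := by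
  rcases le_total 0 (cos θ) with hc | hc
  · have h1 := cos_mul_rho_le hθ (ξ := xi x y) hc
    have h2 := tau_mul_cos_le_one hθ
    rw [r, s₀, div_mul_eq_mul_div]
    gcongr
    linarith
  · have := r_pos (x := x) hy hθ
    have := s₀_pos (x := x) hy
    nlinarith

lemma cos_mul_rho_le_sub_tau {θ : ℝ} (hθ : θ ∈ Ioo (-π) π) (ξ : ℝ) :
    cos θ * rho θ ξ ≤ √(1 + ξ ^ 2) + 2 - tau θ := by
  have h0 := sqrt_nonneg (1 + ξ ^ 2)
  have h3 := tau_mul_cos_le hθ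
  rcases le_total 0 (cos θ) with hc | hc
  · have h1 := cos_mul_rho_le hθ (ξ := ξ) hc
    have h2 : 0 ≤ tau θ * cos θ := mul_nonneg (zero_le_one.trans (one_le_tau hθ)) hc
    linarith
  · nlinarith [tau_le_rho (θ := θ) ξ]

/-- The contour goes to `-∞` at least as fast as `-tau / y`. -/
lemma mul_r_mul_cos_le (hy : 0 < y) {θ : ℝ} (hθ : θ ∈ Ioo (-π) π) :
    y * (r x y θ * cos θ) ≤ √(1 + xi x y ^ 2) + 2 - tau θ := by
  have h1 := cos_mul_rho_le_sub_tau hθ (xi x y)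
  have h2 := tau_mul_cos_le hθ
  have h3 : 2 * (y * (r x y θ * cos θ)) = tau θ * cos θ + cos θ * rho θ (xi x y) := by
    unfold r; field_simp
  linarith [sqrt_nonneg (1 + xi x y ^ 2)]

noncomputable def dr (x y θ : ℝ) : ℝ := dtau θ * (1 + tau θ / rho θ (xi x y)) / (2 * y)

lemma hasDerivAt_r {θ : ℝ} (hθ : θ ∈ Ioo (-π) π) :
    HasDerivAt (r x y) (dr x y θ) θ := by
  have h1 := hasDerivAt_tau hθ
  have hp : tau θ ^ 2 + xi x y ^ 2 ≠ 0 := by nlinarith [one_le_tau hθ, sq_nonneg (xi x y)]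
  have h2 := ((h1.fun_pow 2).add_const (xi x y ^ 2)).sqrt hp
  have h3 := (h1.add h2).div_const (2 * y)
  refine h3.congr_deriv ?_
  have hr := rho_pos hθ (xi x y)
  change _ / (2 * y) = _ / (2 * y)
  rw [show √(tau θ ^ 2 + xi x y ^ 2) = rho θ (xi x y) from rfl]
  congr 1
  simp only [Nat.cast_ofNat]
  field_simp
  ring

lemma abs_dr_le (hy : 0 < y) {θ : ℝ} (hθ : θ ∈ Ioo (-π) π) :
    |dr x y θ| ≤ tau θ ^ 2 / y := by
  have h1 := abs_dtau_le hθ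
  have h2 := rho_pos hθ (xi x y)
  have h3 : tau θ / rho θ (xi x y) ≤ 1 := (div_le_one h2).2 (tau_le_rho _)
  have h4 : 0 ≤ tau θ / rho θ (xi x y) := div_nonneg (by linarith [one_le_tau hθ]) h2.le
  rw [dr, abs_div, abs_mul, abs_of_pos (by positivity : 0 < 2 * y),
    abs_of_nonneg (by linarith : 0 ≤ 1 + tau θ / rho θ (xi x y)), div_le_div_iff₀ (by positivity) hy]
  nlinarith [mul_le_mul h1 (by linarith : 1 + tau θ / rho θ (xi x y) ≤ 2) (by linarith)
    (sq_nonneg (tau θ))]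

/-- The square is wasteful, but it gives `r` the same majorant as its derivative. -/
lemma r_le (hy : 0 < y) {θ : ℝ} (hθ : θ ∈ Ioo (-π) π) :
    r x y θ ≤ s₀ x y * tau θ ^ 2 := by
  have h := one_le_tau hθ
  have h1 : rho θ (xi x y) ≤ √(1 + xi x y ^ 2) * tau θ ^ 2 := by
    refine sqrt_le_iff.2 ⟨by positivity, ?_⟩
    rw [mul_pow, sq_sqrt (by positivity)]
    have h2 : tau θ ^ 2 ≤ (tau θ ^ 2) ^ 2 := by
      nlinarith [one_le_pow₀ (n := 2) h]
    have h3 : 1 ≤ (tau θ ^ 2) ^ 2 := one_le_pow₀ (one_le_pow₀ h)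
    nlinarith [mul_nonneg (sq_nonneg (xi x y)) (sub_nonneg.2 h3)]
  rw [r, s₀, div_mul_eq_mul_div]
  gcongr
  nlinarith

lemma measurable_r : Measurable (r x y) := by
  have := measurable_tau
  unfold r rho
  fun_prop

lemma measurable_dr : Measurable (dr x y) := by
  have := measurable_tau
  unfold dr dtau rho
  fun_prop

lemma tau_div_le_r (hy : 0 < y) (θ : ℝ) : tau θ / y ≤ r x y θ := by
  have := tau_le_rho (θ := θ) (xi x y)
  rw [r, div_le_div_iff₀ hy (by positivity)]
  nlinarith

lemma tendsto_r_right (hy : 0 < y) : Tendsto (r x y) (𝓝[<] π) atTop :=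
  tendsto_atTop_mono (tau_div_le_r hy) (tendsto_tau_right.atTop_div_const hy)

lemma tendsto_r_left (hy : 0 < y) : Tendsto (r x y) (𝓝[>] (-π)) atTop :=
  tendsto_atTop_mono (tau_div_le_r hy) (tendsto_tau_left.atTop_div_const hy)

lemma f_neg (θ : ℝ) : f x y (-θ) = f x y θ := by
  have h : deriv (r x y) (-θ) = -deriv (r x y) θ := by
    have := deriv_comp_neg (r x y) (-θ)
    simp only [neg_neg, r_neg] at this
    exact this
  simp only [f, h, r_neg, sin_neg, cos_neg]
  ring

/-! ### The saddle point -/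

lemma s₀_quadratic (hx : 0 ≤ x) (hy : 0 < y) : y * s₀ x y = 1 + x / s₀ x y := by
  have h := mul_r_sub_div_r hx hy (θ := 0) ⟨by linarith [pi_pos], pi_pos⟩
  rw [r_zero, tau_zero] at h
  linarith

/-- If `s₀ ≥ 1`, then `y ≤ y s₀ = 1 + x / s₀ ≤ 1 + x`, against the hypothesis. -/
lemma s₀_lt_one (hx : 0 ≤ x) (hy : x + 1 < y) : s₀ x y < 1 := by
  have hy0 : 0 < y := by linarith
  have h0 := s₀_pos (x := x) hy0
  have h := s₀_quadratic hx hy0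
  by_contra! h1
  have : x / s₀ x y ≤ x := div_le_self hx h1
  nlinarith

end Radius

/-! ### Hankel's integral along a polar curve -/

/-- The polar curve with radius `R`. -/
noncomputable def polar (R : ℝ → ℝ) (θ : ℝ) : ℂ := R θ * Complex.exp (θ * Complex.I)

/-- The velocity of the polar curve with radius `R`, where `R'` is the derivative of `R`. -/
noncomputable def polarDeriv (R R' : ℝ → ℝ) (θ : ℝ) : ℂ :=
  (R' θ + Complex.I * R θ) * Complex.exp (θ * Complex.I)

section Polar

variable {R R' : ℝ → ℝ} {θ : ℝ}

lemma norm_polar (h : 0 ≤ R θ) : ‖polar R θ‖ = R θ := by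
  rw [polar, norm_mul, Complex.norm_exp_ofReal_mul_I, mul_one, Complex.norm_of_nonneg h]

lemma polar_re : (polar R θ).re = R θ * cos θ := by
  rw [polar, Complex.re_ofReal_mul, Complex.exp_ofReal_mul_I_re]

lemma polar_ne_zero (h : 0 < R θ) : polar R θ ≠ 0 := by
  rw [← norm_pos_iff, norm_polar h.le]; exact h

lemma log_polar (hθ : θ ∈ Ioo (-π) π) (h : 0 < R θ) :
    Complex.log (polar R θ) = Real.log (R θ) + θ * Complex.I := by
  rw [polar, Complex.log_ofReal_mul h (Complex.exp_ne_zero _), Complex.log_exp] <;>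
    simp [hθ.1, hθ.2.le]

lemma polar_mem_slitPlane (hθ : θ ∈ Ioo (-π) π) (h : 0 < R θ) :
    polar R θ ∈ Complex.slitPlane := by
  rw [Complex.mem_slitPlane_iff_arg]
  refine ⟨?_, polar_ne_zero h⟩
  rw [← Complex.log_im, log_polar hθ h]
  simpa using hθ.2.ne

lemma polar_cpow (hθ : θ ∈ Ioo (-π) π) (h : 0 < R θ) (b : ℝ) :
    polar R θ ^ (b : ℂ) = (R θ ^ b : ℝ) * Complex.exp (b * θ * Complex.I) := by
  rw [Complex.cpow_def_of_ne_zero (polar_ne_zero h), log_polar hθ h, rpow_def_of_pos h,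
    Complex.ofReal_exp, ← Complex.exp_add]
  congr 1
  push_cast
  ring

lemma norm_polar_cpow (hθ : θ ∈ Ioo (-π) π) (h : 0 < R θ) (b : ℝ) :
    ‖polar R θ ^ (b : ℂ)‖ = R θ ^ b := by
  rw [polar_cpow hθ h, norm_mul, Complex.norm_of_nonneg (rpow_nonneg h.le _),
    ← Complex.ofReal_mul, Complex.norm_exp_ofReal_mul_I, mul_one]

lemma hasDerivAt_polar (h : HasDerivAt R (R' θ) θ) :
    HasDerivAt (polar R) (polarDeriv R R' θ) θ := by
  have h1 : HasDerivAt (fun t : ℝ => Complex.exp (t * Complex.I))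
      (Complex.exp (θ * Complex.I) * Complex.I) θ := by
    simpa using ((Complex.ofRealCLM.hasDerivAt (x := θ)).mul_const Complex.I).cexp
  refine (h.ofReal_comp.mul h1).congr_deriv ?_
  rw [polarDeriv]
  ring

lemma norm_polarDeriv_le : ‖polarDeriv R R' θ‖ ≤ |R' θ| + |R θ| := by
  rw [polarDeriv, norm_mul, Complex.norm_exp_ofReal_mul_I, mul_one]
  refine (norm_add_le _ _).trans ?_
  simp

end Polar

/-! #### A primitive of `exp s * s ^ (-a)` on the slit plane -/

/-- The entire factor of the primitive. -/
noncomputable def primFactor (a : ℝ) (s : ℂ) : ℂ :=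
  ∫ u in (0 : ℝ)..1, Complex.exp (s * u) * ((u ^ (-a) : ℝ) : ℂ)

section Primitive

variable {a : ℝ}

lemma intervalIntegrable_exp_mul_rpow (s : ℂ) {b : ℝ} (hb : -1 < b) :
    IntervalIntegrable (fun u : ℝ => Complex.exp (s * u) * ((u ^ b : ℝ) : ℂ)) volume 0 1 := by
  have h := intervalIntegral.intervalIntegrable_rpow' (a := 0) (b := 1) hb
  have h' : IntervalIntegrable (fun u : ℝ => ((u ^ b : ℝ) : ℂ)) volume 0 1 :=
    ⟨h.1.ofReal, h.2.ofReal⟩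
  exact h'.continuousOn_mul (Continuous.continuousOn (by fun_prop))

lemma hasDerivAt_primFactor (ha : a < 1) (s : ℂ) :
    HasDerivAt (primFactor a)
      (∫ u in (0 : ℝ)..1, Complex.exp (s * u) * ((u ^ (1 - a) : ℝ) : ℂ)) s := by
  have h := intervalIntegral.hasDerivAt_integral_of_dominated_loc_of_deriv_le
    (𝕜 := ℂ) (μ := volume) (a := 0) (b := 1) (x₀ := s) (s := Metric.ball s 1)
    (F := fun s (u : ℝ) => Complex.exp (s * u) * ((u ^ (-a) : ℝ) : ℂ))
    (F' := fun s (u : ℝ) => Complex.exp (s * u) * ((u ^ (1 - a) : ℝ) : ℂ))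
    (bound := fun _ => Real.exp (‖s‖ + 1))
    (Metric.ball_mem_nhds s one_pos)
    (Eventually.of_forall fun z => by
      refine Measurable.aestronglyMeasurable ?_
      fun_prop)
    (intervalIntegrable_exp_mul_rpow s (by linarith))
    (Measurable.aestronglyMeasurable (by fun_prop)) ?_ intervalIntegrable_const ?_
  · exact h.2
  · refine Eventually.of_forall fun u hu z hz => ?_
    rw [uIoc_of_le zero_le_one] at hu
    have hz' : ‖z‖ ≤ ‖s‖ + 1 := by
      have h1 := norm_le_norm_add_norm_sub' z s
      rw [Metric.mem_ball, dist_eq_norm] at hz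
      linarith
    rw [norm_mul, Complex.norm_exp, Complex.norm_of_nonneg (rpow_nonneg hu.1.le _)]
    have h1 : u ^ (1 - a) ≤ 1 := rpow_le_one hu.1.le hu.2 (by linarith)
    have h2 : (z * u).re ≤ ‖s‖ + 1 := by
      refine (Complex.re_le_norm _).trans ?_
      rw [norm_mul, Complex.norm_of_nonneg hu.1.le]
      nlinarith [norm_nonneg z, hu.2, hu.1]
    have h3 := rpow_nonneg hu.1.le (1 - a)
    calc Real.exp (z * u).re * u ^ (1 - a) ≤ Real.exp (‖s‖ + 1) * 1 := by gcongr
      _ = _ := mul_one _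
  · refine Eventually.of_forall fun u hu z _ => ?_
    rw [uIoc_of_le zero_le_one] at hu
    have h1 : HasDerivAt (fun z : ℂ => Complex.exp (z * u)) (Complex.exp (z * u) * u) z := by
      simpa using ((hasDerivAt_id z).mul_const (u : ℂ)).cexp
    refine (h1.mul_const _).congr_deriv ?_
    rw [show 1 - a = 1 + -a by ring, rpow_add hu.1, rpow_one]
    push_cast
    ring

/-- The integrand is the `u`-derivative of `e^(su) u^(1-a)`, whose value at `u = 0` vanishes because
`a < 1`. -/
lemma primFactor_by_parts (ha : a < 1) (s : ℂ) :
    (1 - a) * primFactor a s +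
      s * ∫ u in (0 : ℝ)..1, Complex.exp (s * u) * ((u ^ (1 - a) : ℝ) : ℂ) = Complex.exp s := by
  have i1 := intervalIntegrable_exp_mul_rpow s (b := -a) (by linarith)
  have i2 := intervalIntegrable_exp_mul_rpow s (b := 1 - a) (by linarith)
  have h := intervalIntegral.integral_eq_sub_of_hasDerivAt_of_le (a := 0) (b := 1)
    (f := fun u : ℝ => Complex.exp (s * u) * ((u ^ (1 - a) : ℝ) : ℂ))
    (f' := fun u : ℝ => (1 - a) * (Complex.exp (s * u) * ((u ^ (-a) : ℝ) : ℂ)) +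
      s * (Complex.exp (s * u) * ((u ^ (1 - a) : ℝ) : ℂ))) zero_le_one ?_ ?_
      ((i1.const_mul _).add (i2.const_mul _))
  · rw [intervalIntegral.integral_add (i1.const_mul _) (i2.const_mul _),
      intervalIntegral.integral_const_mul, intervalIntegral.integral_const_mul] at h
    rw [primFactor, h]
    simp [zero_rpow (by linarith : 1 - a ≠ 0)]
  · refine Continuous.continuousOn ?_
    have : Continuous fun u : ℝ => u ^ (1 - a) := continuous_rpow_const (by linarith)
    fun_prop
  · intro u hu
    have h1 : HasDerivAt (fun u : ℝ => Complex.exp (s * u)) (Complex.exp (s * u) * s) u := by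
      simpa using ((Complex.ofRealCLM.hasDerivAt (x := u)).const_mul s).cexp
    have h2 := (hasDerivAt_rpow_const (x := u) (p := 1 - a) (Or.inl hu.1.ne')).ofReal_comp
    refine (h1.mul h2).congr_deriv ?_
    rw [show 1 - a - 1 = -a by ring]
    push_cast
    ring

/-- This primitive is `∫ e^w w^(-a) dw` along the segment from `0` to `s`, after `w = su`; `a < 1`
makes it converge at `0`. -/
lemma hasDerivAt_cpow_mul_primFactor (ha : a < 1) {s : ℂ} (hs : s ∈ Complex.slitPlane) :
    HasDerivAt (fun s => s ^ ((1 - a : ℝ) : ℂ) * primFactor a s)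
      (Complex.exp s * s ^ ((-a : ℝ) : ℂ)) s := by
  have h1 := (hasDerivAt_id s).cpow_const (c := ((1 - a : ℝ) : ℂ)) hs
  refine (h1.mul (hasDerivAt_primFactor ha s)).congr_deriv ?_
  rw [← primFactor_by_parts ha s]
  have h0 : s ≠ 0 := Complex.slitPlane_ne_zero hs
  have e : s ^ ((1 - a : ℝ) : ℂ) = s ^ ((-a : ℝ) : ℂ) * s := by
    rw [show ((1 - a : ℝ) : ℂ) = ((-a : ℝ) : ℂ) + 1 by push_cast; ring, Complex.cpow_add _ _ h0,
      Complex.cpow_one]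
  have e' : ((1 - a : ℝ) : ℂ) - 1 = ((-a : ℝ) : ℂ) := by push_cast; ring
  simp only [id]
  rw [e, e']
  push_cast
  ring

/-- Along a polar curve, the primitive is an incomplete Gamma integral along a ray. -/
lemma cpow_mul_primFactor_polar {R : ℝ → ℝ} {θ : ℝ} (hθ : θ ∈ Ioo (-π) π) (h : 0 < R θ) :
    polar R θ ^ ((1 - a : ℝ) : ℂ) * primFactor a (polar R θ) =
      Complex.exp ((1 - a : ℝ) * θ * Complex.I) *
        ∫ v in Ioi (0 : ℝ), (Ioc 0 (R θ)).indicator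
          (fun v : ℝ => Complex.exp (v * Complex.exp (θ * Complex.I)) * ((v ^ (-a) : ℝ) : ℂ)) v := by
  rw [polar_cpow hθ h, mul_comm ((R θ ^ (1 - a) : ℝ) : ℂ), mul_assoc]
  congr 1
  rw [setIntegral_indicator measurableSet_Ioc, inter_eq_right.2 Ioc_subset_Ioi_self,
    ← intervalIntegral.integral_of_le h.le]
  have := intervalIntegral.smul_integral_comp_mul_left (a := 0) (b := 1)
    (fun v : ℝ => Complex.exp (v * Complex.exp (θ * Complex.I)) * ((v ^ (-a) : ℝ) : ℂ)) (R θ)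
  rw [mul_zero, mul_one] at this
  rw [← this, primFactor, ← intervalIntegral.integral_const_mul, ← intervalIntegral.integral_smul]
  refine intervalIntegral.integral_congr fun u hu => ?_
  rw [uIcc_of_le zero_le_one] at hu
  simp only [Complex.real_smul]
  rw [mul_rpow h.le hu.1, show 1 - a = 1 + -a by ring, rpow_add h, rpow_one, polar]
  push_cast
  ring_nf

/-- As the ray turns to the negative half-axis and its length goes to infinity, the incomplete Gamma
integral becomes `Γ(1-a)`. The filter is general so that both ends `θ₀ = ±π` are covered. -/
lemma tendsto_cpow_mul_primFactor_polar (ha : a < 1) {R : ℝ → ℝ} {l : Filter ℝ}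
    [l.IsCountablyGenerated] {θ₀ : ℝ} (hl : l ≤ 𝓝 θ₀) (hl' : ∀ᶠ θ in l, θ ∈ Ioo (-π) π)
    (hθ₀ : Complex.exp (θ₀ * Complex.I) = -1) (hR : Tendsto R l atTop) :
    Tendsto (fun θ => polar R θ ^ ((1 - a : ℝ) : ℂ) * primFactor a (polar R θ)) l
      (𝓝 (Complex.exp ((1 - a : ℝ) * θ₀ * Complex.I) * Real.Gamma (1 - a))) := by
  have hcos : cos θ₀ = -1 := by
    rw [← Complex.exp_ofReal_mul_I_re, hθ₀]; simp
  refine Tendsto.congr' ((hl'.and (hR.eventually_gt_atTop 0)).mono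
    fun θ h => (cpow_mul_primFactor_polar h.1 h.2).symm) ?_
  have hG : (Real.Gamma (1 - a) : ℂ) =
      ∫ v in Ioi (0 : ℝ), Complex.exp (v * Complex.exp (θ₀ * Complex.I)) * ((v ^ (-a) : ℝ) : ℂ) := by
    rw [Real.Gamma_eq_integral (by linarith), ← integral_complex_ofReal]
    refine setIntegral_congr_fun measurableSet_Ioi fun v _ => ?_
    rw [hθ₀, show 1 - a - 1 = -a by ring]
    push_cast
    simp
  rw [hG]
  refine Tendsto.mul ?_ ?_
  · refine Tendsto.mono_left (Continuous.tendsto (by fun_prop) θ₀) hl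
  refine tendsto_integral_filter_of_dominated_convergence
    (fun v => v ^ (-a) * Real.exp (-(1 / 2) * v)) ?_ ?_ ?_ ?_
  · refine Eventually.of_forall fun θ => Measurable.aestronglyMeasurable ?_
    exact Measurable.indicator (by fun_prop) measurableSet_Ioc
  -- `cos θ → -1`, so any fixed level above `-1` gives exponential decay uniform in `θ`.
  · have hc : ∀ᶠ θ in l, cos θ < -(1 / 2) :=
      ((continuous_cos.tendsto θ₀).mono_left hl).eventually_lt_const (by rw [hcos]; norm_num)
    filter_upwards [hc] with θ hθ
    filter_upwards [ae_restrict_mem measurableSet_Ioi] with v hv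
    have hv0 : (0 : ℝ) < v := hv
    refine (norm_indicator_le_norm_self _ _).trans ?_
    rw [norm_mul, Complex.norm_exp, Complex.norm_of_nonneg (rpow_nonneg hv0.le _),
      Complex.re_ofReal_mul, Complex.exp_ofReal_mul_I_re, mul_comm]
    have h1 : v * cos θ ≤ -(1 / 2) * v := by nlinarith
    exact mul_le_mul_of_nonneg_left (Real.exp_le_exp.2 h1) (rpow_nonneg hv0.le _)
  · have := integrableOn_rpow_mul_exp_neg_mul_rpow (p := 1) (s := -a) (b := 1 / 2) (by linarith)
      one_pos (by norm_num)
    simpa [IntegrableOn] using this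
  · filter_upwards [ae_restrict_mem measurableSet_Ioi] with v hv
    have hv0 : (0 : ℝ) < v := hv
    have h1 : Tendsto (fun θ : ℝ => Complex.exp (v * Complex.exp (θ * Complex.I)) *
        ((v ^ (-a) : ℝ) : ℂ)) l
        (𝓝 (Complex.exp (v * Complex.exp (θ₀ * Complex.I)) * ((v ^ (-a) : ℝ) : ℂ))) :=
      Tendsto.mono_left (Continuous.tendsto (by fun_prop) θ₀) hl
    refine h1.congr' ?_
    filter_upwards [hR.eventually_ge_atTop v] with θ hθ
    rw [indicator_of_mem (show v ∈ Ioc 0 (R θ) from ⟨hv0, hθ⟩)]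

end Primitive

lemma exp_pi_mul_I_neg : Complex.exp ((-π : ℝ) * Complex.I) = -1 := by
  push_cast
  rw [neg_mul, Complex.exp_neg, Complex.exp_pi_mul_I]
  norm_num

/-- A polar curve that comes from infinity below the negative half-axis, goes around the origin and
returns to infinity above the negative half-axis. -/
structure IsHankelRadius (R R' : ℝ → ℝ) : Prop where
  hasDerivAt : ∀ θ ∈ Ioo (-π) π, HasDerivAt R (R' θ) θ
  bddBelow : ∃ c > 0, ∀ θ ∈ Ioo (-π) π, c ≤ R θ
  tendsto_left : Tendsto R (𝓝[>] (-π)) atTop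
  tendsto_right : Tendsto R (𝓝[<] π) atTop
  integrable : IntegrableOn (fun θ => Complex.exp (polar R θ) * polarDeriv R R' θ) (Ioo (-π) π)

lemma setIntegral_Ioo_eq_sub_of_hasDerivAt_of_tendsto {F F' : ℝ → ℂ} {c d : ℂ} {a b : ℝ}
    (hab : a < b) (hderiv : ∀ x ∈ Ioo a b, HasDerivAt F (F' x) x) (hint : IntegrableOn F' (Ioo a b))
    (ha : Tendsto F (𝓝[>] a) (𝓝 c)) (hb : Tendsto F (𝓝[<] b) (𝓝 d)) :
    ∫ x in Ioo a b, F' x = d - c := by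
  rw [← integral_Ioc_eq_integral_Ioo, ← intervalIntegral.integral_of_le hab.le]
  exact intervalIntegral.integral_eq_sub_of_hasDerivAt_of_tendsto hab hderiv
    ((intervalIntegrable_iff_integrableOn_Ioo_of_le hab.le).2 hint) ha hb

/-- The integrand of Hankel's integral for `2πi / Γ(a)` along a polar curve. -/
noncomputable def hankelIntegrand (R R' : ℝ → ℝ) (a θ : ℝ) : ℂ :=
  polar R θ ^ ((-a : ℝ) : ℂ) * (Complex.exp (polar R θ) * polarDeriv R R' θ)

/-! ### Hankel's formula: `0 < a < 1`, then `a = 1`, then all `a > 0` -/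

namespace IsHankelRadius

variable {R R' : ℝ → ℝ} {a : ℝ}

lemma neg_pi_lt_pi : -π < π := by linarith [pi_pos]

lemma pos (h : IsHankelRadius R R') {θ : ℝ} (hθ : θ ∈ Ioo (-π) π) : 0 < R θ := by
  obtain ⟨c, hc, h1⟩ := h.bddBelow
  exact hc.trans_le (h1 θ hθ)

lemma aestronglyMeasurable_cpow (h : IsHankelRadius R R') (b : ℝ) :
    AEStronglyMeasurable (fun θ => polar R θ ^ (b : ℂ)) (volume.restrict (Ioo (-π) π)) := by
  refine ContinuousOn.aestronglyMeasurable (fun θ hθ => ?_) measurableSet_Ioo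
  have h1 := (hasDerivAt_polar (h.hasDerivAt θ hθ)).continuousAt
  exact (h1.cpow continuousAt_const (polar_mem_slitPlane hθ (h.pos hθ))).continuousWithinAt

/-- The curve stays away from `0`, so integrability of `e^s ds` suffices for every `a ≥ 0`. With `1
≤ C`, the bound is uniform for `a ≤ 1`, as the limit `a → 1` requires. -/
lemma exists_bound (h : IsHankelRadius R R') :
    ∃ C, 1 ≤ C ∧ ∀ a, 0 ≤ a → ∀ θ ∈ Ioo (-π) π, ‖polar R θ ^ ((-a : ℝ) : ℂ)‖ ≤ C ^ a := by
  obtain ⟨c, hc, h1⟩ := h.bddBelow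
  refine ⟨max 1 c⁻¹, le_max_left _ _, fun a ha θ hθ => ?_⟩
  rw [norm_polar_cpow hθ (h.pos hθ), rpow_neg (h.pos hθ).le, ← inv_rpow (h.pos hθ).le]
  refine rpow_le_rpow (inv_nonneg.2 (h.pos hθ).le) ?_ ha
  exact (inv_anti₀ hc (h1 θ hθ)).trans (le_max_right _ _)

lemma integrableOn_hankelIntegrand (h : IsHankelRadius R R') (ha : 0 ≤ a) :
    IntegrableOn (hankelIntegrand R R' a) (Ioo (-π) π) := by
  obtain ⟨C, -, hC⟩ := h.exists_bound
  refine Integrable.bdd_mul (c := C ^ a) h.integrable (h.aestronglyMeasurable_cpow _) ?_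
  filter_upwards [ae_restrict_mem measurableSet_Ioo] with θ hθ using hC a ha θ hθ

/-- The end values of the primitive differ by `(e^(iπ(1-a)) - e^(-iπ(1-a))) Γ(1-a) = 2i sin(πa)
Γ(1-a)`; the reflection formula finishes. -/
lemma hankel_aux_of_lt_one (h : IsHankelRadius R R') (ha : 0 < a) (ha1 : a < 1) :
    ∫ θ in Ioo (-π) π, hankelIntegrand R R' a θ = 2 * π * Complex.I / Real.Gamma a := by
  have hm : ∀ l : Filter ℝ, l = 𝓝[>] (-π) ∨ l = 𝓝[<] π → ∀ᶠ θ in l, θ ∈ Ioo (-π) π := by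
    rintro l (rfl | rfl)
    · exact Ioo_mem_nhdsGT neg_pi_lt_pi
    · exact Ioo_mem_nhdsLT neg_pi_lt_pi
  rw [setIntegral_Ioo_eq_sub_of_hasDerivAt_of_tendsto neg_pi_lt_pi
    (F := fun θ => polar R θ ^ ((1 - a : ℝ) : ℂ) * primFactor a (polar R θ)) (fun θ hθ => ?_)
    (h.integrableOn_hankelIntegrand ha.le)
    (tendsto_cpow_mul_primFactor_polar ha1 nhdsWithin_le_nhds (hm _ (Or.inl rfl))
      exp_pi_mul_I_neg h.tendsto_left)
    (tendsto_cpow_mul_primFactor_polar ha1 nhdsWithin_le_nhds (hm _ (Or.inr rfl))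
      Complex.exp_pi_mul_I h.tendsto_right)]
  · have h1 := Real.Gamma_mul_Gamma_one_sub a
    have hs : sin (π * a) ≠ 0 := (sin_pos_of_pos_of_lt_pi (by positivity) (by nlinarith [pi_pos])).ne'
    have hG := (Real.Gamma_pos_of_pos ha).ne'
    have h2 : Real.Gamma (1 - a) = π / (sin (π * a) * Real.Gamma a) := by
      field_simp at h1 ⊢
      linarith
    have h3 : Complex.exp ((1 - a : ℝ) * π * Complex.I) -
        Complex.exp ((1 - a : ℝ) * (-π : ℝ) * Complex.I) = 2 * Complex.I * sin (π * a) := by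
      have e1 : ((1 - a : ℝ) : ℂ) * π * Complex.I = ((π - π * a : ℝ) : ℂ) * Complex.I := by
        push_cast; ring
      have e2 : ((1 - a : ℝ) : ℂ) * (-π : ℝ) * Complex.I = ((-(π - π * a) : ℝ) : ℂ) * Complex.I := by
        push_cast; ring
      rw [e1, e2, Complex.exp_mul_I, Complex.exp_mul_I, ← Complex.ofReal_cos, ← Complex.ofReal_sin,
        ← Complex.ofReal_cos, ← Complex.ofReal_sin, Real.cos_neg, Real.sin_neg, Real.sin_pi_sub]
      push_cast
      ring
    rw [← sub_mul, h3, h2]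
    have hs' : ((sin (π * a) : ℝ) : ℂ) ≠ 0 := Complex.ofReal_ne_zero.2 hs
    have hG' : (Real.Gamma a : ℂ) ≠ 0 := Complex.ofReal_ne_zero.2 hG
    push_cast at hs' ⊢
    field_simp
  · have h1 := (hasDerivAt_cpow_mul_primFactor ha1 (polar_mem_slitPlane hθ (h.pos hθ))).comp θ
      (hasDerivAt_polar (h.hasDerivAt θ hθ))
    refine h1.congr_deriv ?_
    rw [hankelIntegrand]
    ring

/-- Neither the primitive (`a < 1`) nor the recurrence (from `a > 0` to `a + 1`) reaches `a = 1`;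
both sides are continuous from the left there. -/
lemma hankel_aux_one (h : IsHankelRadius R R') :
    ∫ θ in Ioo (-π) π, hankelIntegrand R R' 1 θ = 2 * π * Complex.I / Real.Gamma 1 := by
  obtain ⟨C, hC1, hC⟩ := h.exists_bound
  have hev : ∀ᶠ a : ℝ in 𝓝[<] 1, a ∈ Ioo 0 1 := Ioo_mem_nhdsLT one_pos
  have h1 : Tendsto (fun a => ∫ θ in Ioo (-π) π, hankelIntegrand R R' a θ) (𝓝[<] 1)
      (𝓝 (∫ θ in Ioo (-π) π, hankelIntegrand R R' 1 θ)) := by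
    refine tendsto_integral_filter_of_dominated_convergence
      (fun θ => C * ‖Complex.exp (polar R θ) * polarDeriv R R' θ‖) ?_ ?_ ?_ ?_
    · filter_upwards [hev] with a ha
      exact (h.integrableOn_hankelIntegrand ha.1.le).aestronglyMeasurable
    · filter_upwards [hev] with a ha
      filter_upwards [ae_restrict_mem measurableSet_Ioo] with θ hθ
      rw [hankelIntegrand, norm_mul]
      gcongr
      refine (hC a ha.1.le θ hθ).trans ?_
      simpa using rpow_le_rpow_of_exponent_le hC1 ha.2.le
    · exact h.integrable.norm.const_mul _
    · filter_upwards [ae_restrict_mem measurableSet_Ioo] with θ hθ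
      refine Tendsto.mul_const _ ?_
      have : ContinuousAt (fun a : ℝ => polar R θ ^ ((-a : ℝ) : ℂ)) 1 :=
        ContinuousAt.const_cpow (by fun_prop) (Or.inl (polar_ne_zero (h.pos hθ)))
      exact this.tendsto.mono_left nhdsWithin_le_nhds
  have h2 : Tendsto (fun a => ∫ θ in Ioo (-π) π, hankelIntegrand R R' a θ) (𝓝[<] 1)
      (𝓝 (2 * π * Complex.I / Real.Gamma 1)) := by
    have hG : ContinuousAt Real.Gamma 1 :=
      (Real.differentiableAt_Gamma fun m hm => by
        have : (0 : ℝ) ≤ m := m.cast_nonneg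
        linarith).continuousAt
    have h3 : ContinuousAt (fun a => 2 * π * Complex.I / (Real.Gamma a : ℂ)) 1 :=
      continuousAt_const.div (Complex.continuous_ofReal.continuousAt.comp hG) (by simp)
    refine (h3.tendsto.mono_left nhdsWithin_le_nhds).congr' ?_
    filter_upwards [hev] with a ha using (h.hankel_aux_of_lt_one ha.1 ha.2).symm
  exact tendsto_nhds_unique h1 h2

lemma tendsto_boundary (h : IsHankelRadius R R') (ha : 0 < a) {l : Filter ℝ}
    (hl : ∀ᶠ θ in l, θ ∈ Ioo (-π) π ∧ cos θ ≤ 0) (hR : Tendsto R l atTop) :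
    Tendsto (fun θ => polar R θ ^ ((-a : ℝ) : ℂ) * Complex.exp (polar R θ)) l (𝓝 0) := by
  refine squeeze_zero_norm' ?_ ((tendsto_rpow_neg_atTop ha).comp hR)
  filter_upwards [hl] with θ ⟨hθ, hc⟩
  rw [norm_mul, norm_polar_cpow hθ (h.pos hθ), Complex.norm_exp, polar_re]
  refine mul_le_of_le_one_right (rpow_nonneg (h.pos hθ).le _) (exp_le_one_iff.2 ?_)
  exact mul_nonpos_of_nonneg_of_nonpos (h.pos hθ).le hc

/-- Integrate `d(s^(-a) e^s) = (s^(-a) - a s^(-a-1)) e^s ds`; the boundary terms are at most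
`R^(-a)` in modulus once `cos θ ≤ 0`. -/
lemma hankel_recurrence (h : IsHankelRadius R R') (ha : 0 < a) :
    ∫ θ in Ioo (-π) π, hankelIntegrand R R' a θ =
      a * ∫ θ in Ioo (-π) π, hankelIntegrand R R' (a + 1) θ := by
  have i1 := h.integrableOn_hankelIntegrand ha.le
  have i2 := h.integrableOn_hankelIntegrand (a := a + 1) (by linarith)
  have key := setIntegral_Ioo_eq_sub_of_hasDerivAt_of_tendsto neg_pi_lt_pi
    (F := fun θ => polar R θ ^ ((-a : ℝ) : ℂ) * Complex.exp (polar R θ))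
    (F' := fun θ => hankelIntegrand R R' a θ - a * hankelIntegrand R R' (a + 1) θ)
    (fun θ hθ => ?_) (i1.sub (i2.const_mul _))
    (h.tendsto_boundary ha ?_ h.tendsto_left) (h.tendsto_boundary ha ?_ h.tendsto_right)
  · rw [integral_sub i1 (i2.const_mul _), integral_const_mul, sub_zero, sub_eq_zero] at key
    exact key
  · have h1 := hasDerivAt_polar (h.hasDerivAt θ hθ)
    have hs := polar_mem_slitPlane hθ (h.pos hθ)
    have h2 := ((hasDerivAt_id (polar R θ)).cpow_const (c := ((-a : ℝ) : ℂ)) hs).comp θ h1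
    refine (h2.mul h1.cexp).congr_deriv ?_
    simp only [hankelIntegrand, id, Function.comp]
    rw [show ((-(a + 1) : ℝ) : ℂ) = ((-a : ℝ) : ℂ) - 1 by push_cast; ring]
    push_cast
    ring
  · filter_upwards [Ioo_mem_nhdsGT (show -π < -(π / 2) by linarith [pi_pos])] with θ hθ
    refine ⟨⟨hθ.1, by linarith [hθ.2, pi_pos]⟩, ?_⟩
    rw [← cos_neg]
    exact cos_nonpos_of_pi_div_two_le_of_le (by linarith [hθ.2]) (by linarith [hθ.1, pi_pos])
  · filter_upwards [Ioo_mem_nhdsLT (show π / 2 < π by linarith [pi_pos])] with θ hθ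
    exact ⟨⟨by linarith [hθ.1, pi_pos], hθ.2⟩,
      cos_nonpos_of_pi_div_two_le_of_le hθ.1.le (by linarith [hθ.2, pi_pos])⟩

/-- **Hankel's integral** for the reciprocal Gamma function. -/
theorem hankel (h : IsHankelRadius R R') (ha : 0 < a) :
    ∫ θ in Ioo (-π) π, hankelIntegrand R R' a θ = 2 * π * Complex.I / Real.Gamma a := by
  have key : ∀ n : ℕ, ∀ a : ℝ, 0 < a → a ≤ n + 1 →
      ∫ θ in Ioo (-π) π, hankelIntegrand R R' a θ = 2 * π * Complex.I / Real.Gamma a := by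
    intro n
    induction n with
    | zero =>
      intro a ha han
      rcases (show a ≤ 1 by simpa using han).lt_or_eq with h1 | rfl
      · exact h.hankel_aux_of_lt_one ha h1
      · exact h.hankel_aux_one
    | succ n ih =>
      intro a ha han
      rcases le_or_gt a 1 with h1 | h1
      · exact ih a ha (by have : (0 : ℝ) ≤ n := n.cast_nonneg
                          linarith)
      · have hb : 0 < a - 1 := by linarith
        have h2 := ih (a - 1) hb (by push_cast at han; linarith)
        rw [h.hankel_recurrence hb, sub_add_cancel] at h2
        have h3 := Real.Gamma_add_one hb.ne'
        rw [sub_add_cancel] at h3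
        have hG : (Real.Gamma (a - 1) : ℂ) ≠ 0 :=
          Complex.ofReal_ne_zero.2 (Real.Gamma_pos_of_pos hb).ne'
        have hb' : ((a - 1 : ℝ) : ℂ) ≠ 0 := Complex.ofReal_ne_zero.2 hb.ne'
        rw [h3]
        push_cast at hb' h2 ⊢
        rw [← mul_right_inj' hb', h2]
        field_simp
  obtain ⟨n, hn⟩ := exists_nat_ge a
  exact key n a ha (by linarith)

end IsHankelRadius

/-! ### The contour of steepest descent -/

section Contour

variable {x y : ℝ}

/-- The steepest descent contour. -/
noncomputable def contour (x y : ℝ) : ℝ → ℂ := polar (r x y)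

noncomputable def contourDeriv (x y : ℝ) : ℝ → ℂ := polarDeriv (r x y) (dr x y)

lemma measurable_contour : Measurable (contour x y) := by
  have : Measurable (r x y) := measurable_r
  unfold contour polar
  fun_prop

lemma measurable_contourDeriv : Measurable (contourDeriv x y) := by
  have h1 : Measurable (r x y) := measurable_r
  have h2 : Measurable (dr x y) := measurable_dr
  unfold contourDeriv polarDeriv
  fun_prop

lemma contour_ne_zero (hy : 0 < y) {θ : ℝ} (hθ : θ ∈ Ioo (-π) π) : contour x y θ ≠ 0 :=
  polar_ne_zero (r_pos hy hθ)

lemma contour_re_le (hy : 0 < y) {θ : ℝ} (hθ : θ ∈ Ioo (-π) π) :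
    (contour x y θ).re ≤ s₀ x y := by
  rw [contour, polar_re]
  exact r_mul_cos_le hy hθ

lemma norm_contourDeriv_le (hy : 0 < y) {θ : ℝ} (hθ : θ ∈ Ioo (-π) π) :
    ‖contourDeriv x y θ‖ ≤ (y⁻¹ + s₀ x y) * tau θ ^ 2 := by
  have h1 := abs_dr_le (x := x) hy hθ
  have h2 := r_le (x := x) hy hθ
  refine norm_polarDeriv_le.trans ?_
  rw [abs_of_pos (r_pos hy hθ), add_mul, inv_mul_eq_div]
  exact add_le_add h1 h2

lemma integrableOn_exp_mul_contourDeriv (hy : 0 < y) {t : ℝ} (ht : 0 < t) :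
    IntegrableOn (fun θ => Complex.exp (t * contour x y θ) * contourDeriv x y θ) (Ioo (-π) π) := by
  set M := √(1 + xi x y ^ 2) + 2
  have hs := s₀_pos (x := x) hy
  have hc : 0 < t / y := by positivity
  refine Integrable.mono' (g := fun _ => Real.exp (t / y * M) * ((y⁻¹ + s₀ x y) * (2 / (t / y) ^ 2)))
    (integrable_const _) ?_ ?_
  · have h1 : Measurable (contour x y) := measurable_contour
    have h2 : Measurable (contourDeriv x y) := measurable_contourDeriv
    exact Measurable.aestronglyMeasurable (by fun_prop)
  · filter_upwards [ae_restrict_mem measurableSet_Ioo] with θ hθ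
    have h1 := mul_r_mul_cos_le (x := x) hy hθ
    have h2 : t * (contour x y θ).re ≤ t / y * M - t / y * tau θ := by
      rw [contour, polar_re, ← mul_sub, div_mul_eq_mul_div, le_div_iff₀ hy]
      nlinarith
    -- From `u² / 2 ≤ e^u` at `u = (t / y) tau`. Thus the integrand is bounded, which is enough on a
    -- bounded interval.
    have h3 : tau θ ^ 2 * Real.exp (-(t / y * tau θ)) ≤ 2 / (t / y) ^ 2 := by
      have h4 : 0 ≤ t / y * tau θ := mul_nonneg hc.le (by linarith [one_le_tau hθ])
      have h5 := Real.quadratic_le_exp_of_nonneg h4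
      rw [Real.exp_neg, ← div_eq_mul_inv, div_le_div_iff₀ (Real.exp_pos _) (by positivity)]
      nlinarith
    rw [norm_mul, Complex.norm_exp, Complex.re_ofReal_mul]
    calc Real.exp (t * (contour x y θ).re) * ‖contourDeriv x y θ‖
        ≤ Real.exp (t / y * M - t / y * tau θ) * ((y⁻¹ + s₀ x y) * tau θ ^ 2) := by
          gcongr
          exact norm_contourDeriv_le hy hθ
      _ = Real.exp (t / y * M) *
          ((y⁻¹ + s₀ x y) * (tau θ ^ 2 * Real.exp (-(t / y * tau θ)))) := by
          rw [sub_eq_add_neg, Real.exp_add]; ring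
      _ ≤ _ := by gcongr

lemma polar_const_mul (t θ : ℝ) : polar (fun θ => t * r x y θ) θ = t * contour x y θ := by
  simp only [polar, contour]; push_cast; ring

lemma polarDeriv_const_mul (t θ : ℝ) :
    polarDeriv (fun θ => t * r x y θ) (fun θ => t * dr x y θ) θ = t * contourDeriv x y θ := by
  simp only [polarDeriv, contourDeriv]; push_cast; ring

/-- Scaling the contour by `t` turns the kernel `e^s` of Hankel's integral into `e^(ts)`. -/
lemma isHankelRadius (hy : 0 < y) {t : ℝ} (ht : 0 < t) :
    IsHankelRadius (fun θ => t * r x y θ) (fun θ => t * dr x y θ) where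
  hasDerivAt θ hθ := (hasDerivAt_r hθ).const_mul t
  bddBelow := ⟨t * s₀ x y, mul_pos ht (s₀_pos hy),
    fun θ hθ => mul_le_mul_of_nonneg_left (s₀_le_r hy hθ) ht.le⟩
  tendsto_left := (tendsto_r_left hy).const_mul_atTop ht
  tendsto_right := (tendsto_r_right hy).const_mul_atTop ht
  integrable := by
    simp only [polar_const_mul, polarDeriv_const_mul]
    refine IntegrableOn.congr_fun ((integrableOn_exp_mul_contourDeriv (x := x) hy ht).const_mul
      (t : ℂ)) (fun θ _ => ?_) measurableSet_Ioo
    ring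

lemma hankelIntegrand_const_mul (hy : 0 < y) {t : ℝ} (ht : 0 < t) (a : ℝ) {θ : ℝ}
    (hθ : θ ∈ Ioo (-π) π) :
    hankelIntegrand (fun θ => t * r x y θ) (fun θ => t * dr x y θ) a θ =
      (t ^ (1 - a) : ℝ) * (contour x y θ ^ ((-a : ℝ) : ℂ) *
        (Complex.exp (t * contour x y θ) * contourDeriv x y θ)) := by
  have hr := r_pos (x := x) hy hθ
  rw [hankelIntegrand, polar_cpow (R := fun θ => t * r x y θ) hθ (mul_pos ht hr), mul_rpow ht.le hr.le, polar_const_mul,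
    polarDeriv_const_mul, contour, polar_cpow hθ hr, show 1 - a = -a + 1 by ring, rpow_add ht,
    rpow_one]
  push_cast
  ring

lemma integrableOn_cpow_mul (hy : 0 < y) {t : ℝ} (ht : 0 < t) {a : ℝ} (ha : 0 ≤ a) :
    IntegrableOn (fun θ => contour x y θ ^ ((-a : ℝ) : ℂ) *
      (Complex.exp (t * contour x y θ) * contourDeriv x y θ)) (Ioo (-π) π) := by
  have h := (isHankelRadius (x := x) hy ht).integrableOn_hankelIntegrand ha
  refine IntegrableOn.congr_fun (h.const_mul ((t ^ (a - 1) : ℝ) : ℂ)) (fun θ hθ => ?_)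
    measurableSet_Ioo
  have e : ((t ^ (a - 1) : ℝ) : ℂ) * ((t ^ (1 - a) : ℝ) : ℂ) = 1 := by
    rw [← Complex.ofReal_mul, ← rpow_add ht]; simp
  rw [hankelIntegrand_const_mul hy ht a hθ, ← mul_assoc, e, one_mul]

/-- Hankel's integral along the contour of steepest descent. -/
lemma hankel_contour (hy : 0 < y) {t : ℝ} (ht : 0 < t) {a : ℝ} (ha : 0 < a) :
    ∫ θ in Ioo (-π) π, contour x y θ ^ ((-a : ℝ) : ℂ) *
        (Complex.exp (t * contour x y θ) * contourDeriv x y θ) =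
      2 * π * Complex.I * (t ^ (a - 1) / Real.Gamma a : ℝ) := by
  have h := (isHankelRadius (x := x) hy ht).hankel ha
  rw [setIntegral_congr_fun measurableSet_Ioo
    (fun θ hθ => hankelIntegrand_const_mul (x := x) hy ht a hθ), integral_const_mul] at h
  have e : ((t ^ (a - 1) : ℝ) : ℂ) * ((t ^ (1 - a) : ℝ) : ℂ) = 1 := by
    rw [← Complex.ofReal_mul, ← rpow_add ht]; simp
  rw [← one_mul (∫ θ in Ioo (-π) π, _), ← e, mul_assoc, h]
  push_cast
  ring

end Contour

/-! ### The integrand of the Marcum function as a contour integral -/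

/-- The powers of `X` cancel, leaving a series that also covers `X = 0`, where only the term `n = 0`
survives. -/
lemma integrand_eq_tsum {μ X t : ℝ} (hX : 0 ≤ X) (ht : 0 < t) :
    integrand μ X t = Real.exp (-t - X) * (t ^ (μ - 1) *
      ∑' n : ℕ, (X * t) ^ n / ((n.factorial : ℝ) * Real.Gamma (μ + n))) := by
  rcases hX.eq_or_lt with rfl | hX
  · rw [integrand, if_pos rfl, tsum_eq_single 0 (fun n hn => by simp [hn])]
    simp
    ring
  · rw [integrand, if_neg hX.ne', besselI, show 2 * √(X * t) / 2 = √(X * t) by ring]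
    have e1 : √(X * t) ^ (μ - 1) = X ^ ((μ - 1) / 2) * t ^ ((μ - 1) / 2) := by
      rw [sqrt_eq_rpow, ← rpow_mul (by positivity), mul_rpow hX.le ht.le]
      ring_nf
    have e2 : X ^ ((1 - μ) / 2) * X ^ ((μ - 1) / 2) = 1 := by
      rw [← rpow_add hX]; ring_nf; exact rpow_zero _
    have e3 : t ^ ((μ - 1) / 2) * t ^ ((μ - 1) / 2) = t ^ (μ - 1) := by
      rw [← rpow_add ht]; ring_nf
    have e4 : ∀ n : ℕ, √(X * t) ^ (2 * n) / ((n.factorial : ℝ) * Real.Gamma (μ - 1 + n + 1)) =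
        (X * t) ^ n / ((n.factorial : ℝ) * Real.Gamma (μ + n)) := fun n => by
      rw [pow_mul, sq_sqrt (by positivity), show μ - 1 + n + 1 = μ + n by ring]
    simp_rw [e4]
    rw [e1, ← e3]
    linear_combination (Real.exp (-t - X) * (t ^ ((μ - 1) / 2) * t ^ ((μ - 1) / 2) *
      ∑' n : ℕ, (X * t) ^ n / ((n.factorial : ℝ) * Real.Gamma (μ + n)))) * e2

section Representation

variable {x y : ℝ}

/-- The contour integrand of the Marcum function at its lower limit, without the factor
`1 / (1 - s)`. -/
noncomputable def weight (x y μ X Y θ : ℝ) : ℂ :=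
  Complex.exp (X / contour x y θ) * (contour x y θ ^ ((-μ : ℝ) : ℂ) *
    (Complex.exp (Y * contour x y θ) * contourDeriv x y θ))

lemma norm_div_contour_le (hy : 0 < y) {X : ℝ} (hX : 0 ≤ X) {θ : ℝ} (hθ : θ ∈ Ioo (-π) π) :
    ‖(X : ℂ) / contour x y θ‖ ≤ X / s₀ x y := by
  rw [norm_div, Complex.norm_of_nonneg hX, contour, norm_polar (r_pos hy hθ).le]
  have := s₀_pos (x := x) hy
  gcongr
  exact s₀_le_r hy hθ

lemma integrableOn_weight (hy : 0 < y) {μ X Y : ℝ} (hμ : 0 < μ) (hX : 0 ≤ X) (hY : 0 < Y) :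
    IntegrableOn (weight x y μ X Y) (Ioo (-π) π) := by
  refine Integrable.bdd_mul (c := Real.exp (X / s₀ x y)) (integrableOn_cpow_mul hy hY hμ.le) ?_ ?_
  · have h1 : Measurable (contour x y) := measurable_contour
    exact Measurable.aestronglyMeasurable (by fun_prop)
  · filter_upwards [ae_restrict_mem measurableSet_Ioo] with θ hθ
    refine (Complex.norm_exp_le_exp_norm _).trans ?_
    exact Real.exp_le_exp.2 (norm_div_contour_le hy hX hθ)

/-- Expand `e^(X/s)` in powers of `X/s`: the `n`-th term is Hankel's integral with exponent `μ + n`.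
Domination comes from `|X/s| ≤ X/s₀`. -/
lemma integral_weight (hy : 0 < y) {μ X t : ℝ} (hμ : 0 < μ) (hX : 0 ≤ X) (ht : 0 < t) :
    ∫ θ in Ioo (-π) π, weight x y μ X t θ = 2 * π * Complex.I * (t ^ (μ - 1) *
      ∑' n : ℕ, (X * t) ^ n / ((n.factorial : ℝ) * Real.Gamma (μ + n)) : ℝ) := by
  have i0 := integrableOn_cpow_mul (x := x) hy ht hμ.le
  have key := hasSum_integral_of_dominated_convergence (μ := volume.restrict (Ioo (-π) π))
    (F := fun (n : ℕ) θ => ((X : ℂ) / contour x y θ) ^ n / n.factorial *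
      (contour x y θ ^ ((-μ : ℝ) : ℂ) * (Complex.exp (t * contour x y θ) * contourDeriv x y θ)))
    (f := weight x y μ X t)
    (fun n θ => (X / s₀ x y) ^ n / n.factorial *
      ‖contour x y θ ^ ((-μ : ℝ) : ℂ) * (Complex.exp (t * contour x y θ) * contourDeriv x y θ)‖)
    ?_ ?_ ?_ ?_ ?_
  · rw [← key.tsum_eq, ← tsum_mul_left, Complex.ofReal_tsum, ← tsum_mul_left]
    refine tsum_congr fun n => ?_
    have hn : 0 < μ + n := by positivity
    have e : ∀ θ ∈ Ioo (-π) π, ((X : ℂ) / contour x y θ) ^ n / n.factorial *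
        (contour x y θ ^ ((-μ : ℝ) : ℂ) * (Complex.exp (t * contour x y θ) * contourDeriv x y θ)) =
        (X : ℂ) ^ n / n.factorial * (contour x y θ ^ ((-(μ + n) : ℝ) : ℂ) *
          (Complex.exp (t * contour x y θ) * contourDeriv x y θ)) := fun θ hθ => by
      rw [show ((-(μ + n) : ℝ) : ℂ) = ((-μ : ℝ) : ℂ) - (n : ℂ) by push_cast; ring,
        Complex.cpow_sub _ _ (contour_ne_zero hy hθ), Complex.cpow_natCast, div_pow]
      ring
    rw [setIntegral_congr_fun measurableSet_Ioo e, integral_const_mul, hankel_contour hy ht hn,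
      show μ + n - 1 = μ - 1 + n by ring, rpow_add ht, rpow_natCast]
    push_cast
    rw [mul_pow]
    field_simp
  · intro n
    have h1 : Measurable (contour x y) := measurable_contour
    exact (Measurable.aestronglyMeasurable (by fun_prop)).mul i0.aestronglyMeasurable
  · intro n
    filter_upwards [ae_restrict_mem measurableSet_Ioo] with θ hθ
    rw [norm_mul, norm_div, norm_pow, Complex.norm_natCast]
    gcongr
    exact norm_div_contour_le hy hX hθ
  · refine Eventually.of_forall fun θ => Summable.mul_right _ ?_
    exact Real.summable_pow_div_factorial _
  · simp_rw [tsum_mul_right]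
    exact i0.norm.const_mul _
  · refine Eventually.of_forall fun θ => HasSum.mul_right _ ?_
    rw [Complex.exp_eq_exp_ℂ]
    exact NormedSpace.expSeries_div_hasSum_exp _

lemma integrand_eq_integral (hy : 0 < y) {μ X t : ℝ} (hμ : 0 < μ) (hX : 0 ≤ X) (ht : 0 < t) :
    (integrand μ X t : ℂ) = Complex.exp (-t - X) / (2 * π * Complex.I) *
      ∫ θ in Ioo (-π) π, weight x y μ X t θ := by
  rw [integral_weight hy hμ hX ht, integrand_eq_tsum hX ht, Complex.ofReal_mul,
    Complex.ofReal_exp]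
  have := Complex.two_pi_I_ne_zero
  push_cast
  field_simp

end Representation

/-! ### Integration over `t` under the contour integral -/

section Fubini

variable {x y μ X Y : ℝ}

/-- All dependence on `t` moves into `e^((s-1)t)`. The remaining factor is written through the
weight at `Y`, whose integrability then serves all `t > Y`. -/
lemma weight_eq_exp_mul (t θ : ℝ) :
    Complex.exp (-t - X) * weight x y μ X t θ = Complex.exp (-X) *
      (Complex.exp ((contour x y θ - 1) * t) *
        (Complex.exp (-Y * contour x y θ) * weight x y μ X Y θ)) := by
  have e1 : Complex.exp (-t - X) * Complex.exp (t * contour x y θ) =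
      Complex.exp (-X) * Complex.exp ((contour x y θ - 1) * t) := by
    rw [← Complex.exp_add, ← Complex.exp_add]; ring_nf
  have e2 : Complex.exp (-Y * contour x y θ) * Complex.exp (Y * contour x y θ) = 1 := by
    rw [← Complex.exp_add, neg_mul, neg_add_cancel, Complex.exp_zero]
  simp only [weight]
  linear_combination (Complex.exp (X / contour x y θ) * contour x y θ ^ ((-μ : ℝ) : ℂ) *
    contourDeriv x y θ) * e1 - (Complex.exp (X / contour x y θ) * contour x y θ ^ ((-μ : ℝ) : ℂ) *
    contourDeriv x y θ * Complex.exp (-X) * Complex.exp ((contour x y θ - 1) * t)) * e2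

/-- For `t > Y`, `|e^((s-1)t - Ys)| = e^((t-Y) Re s - t) ≤ e^(-s₀Y) e^((s₀-1)t)`, and `s₀ < 1`. -/
lemma integrable_exp_mul_weight (hx : 0 ≤ x) (hy : x + 1 < y) (hμ : 0 < μ) (hX : 0 ≤ X)
    (hY : 0 < Y) :
    Integrable (fun z : ℝ × ℝ => Complex.exp ((contour x y z.2 - 1) * z.1) *
        (Complex.exp (-Y * contour x y z.2) * weight x y μ X Y z.2))
      ((volume.restrict (Ioi Y)).prod (volume.restrict (Ioo (-π) π))) := by
  have hy0 : 0 < y := by linarith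
  have hs := s₀_lt_one hx hy
  have hW := integrableOn_weight (x := x) hy0 hμ hX hY
  have hE : IntegrableOn (fun t => Real.exp ((s₀ x y - 1) * t)) (Ioi Y) :=
    integrableOn_exp_mul_Ioi (by linarith) Y
  have hE' := Integrable.mul_prod (hE.const_mul (Real.exp (-s₀ x y * Y))) hW.norm
  have hc : Measurable (contour x y) := measurable_contour
  refine hE'.mono' ?_ ?_
  · exact (Measurable.aestronglyMeasurable (by fun_prop)).mul
      ((Measurable.aestronglyMeasurable (by fun_prop)).mul hW.aestronglyMeasurable.comp_snd)
  · rw [Measure.prod_restrict]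
    filter_upwards [ae_restrict_mem (measurableSet_Ioi.prod measurableSet_Ioo)] with z hz
    have h1 : (contour x y z.2).re ≤ s₀ x y := contour_re_le hy0 hz.2
    have h2 : Y < z.1 := hz.1
    rw [← mul_assoc, norm_mul, ← Complex.exp_add, Complex.norm_exp, ← Real.exp_add]
    gcongr
    simp only [Complex.add_re, Complex.mul_re, Complex.sub_re, Complex.sub_im, Complex.neg_re,
      Complex.neg_im, Complex.ofReal_re, Complex.ofReal_im, Complex.one_re, Complex.one_im]
    nlinarith

lemma integrand_eq_integral_exp (hy : 0 < y) (hμ : 0 < μ) (hX : 0 ≤ X) {t : ℝ} (ht : 0 < t) :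
    (integrand μ X t : ℂ) = Complex.exp (-X) / (2 * π * Complex.I) * ∫ θ in Ioo (-π) π,
      Complex.exp ((contour x y θ - 1) * t) *
        (Complex.exp (-Y * contour x y θ) * weight x y μ X Y θ) := by
  rw [integrand_eq_integral (x := x) hy hμ hX ht, div_mul_eq_mul_div, div_mul_eq_mul_div,
    ← integral_const_mul, ← integral_const_mul]
  simp_rw [weight_eq_exp_mul (Y := Y)]

lemma integrableOn_integrand (hx : 0 ≤ x) (hy : x + 1 < y) (hμ : 0 < μ) (hX : 0 ≤ X) (hY : 0 < Y) :
    IntegrableOn (integrand μ X) (Ioi Y) := by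
  have h := ((integrable_exp_mul_weight (Y := Y) hx hy hμ hX hY).integral_prod_left.const_mul
    (Complex.exp (-X) / (2 * π * Complex.I))).re
  refine IntegrableOn.congr_fun h (fun t ht => ?_) measurableSet_Ioi
  have := integrand_eq_integral_exp (x := x) (y := y) (Y := Y) (by linarith) hμ hX (hY.trans ht)
  simp only
  rw [← this]
  simp

/-- The Marcum function as an integral along the contour of steepest descent. -/
lemma Q_eq_integral (hx : 0 ≤ x) (hy : x + 1 < y) (hμ : 0 < μ) (hX : 0 ≤ X) (hY : 0 < Y) :
    (Q μ X Y : ℂ) = Complex.exp (-X - Y) / (2 * π * Complex.I) *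
      ∫ θ in Ioo (-π) π, weight x y μ X Y θ / (1 - contour x y θ) := by
  have hy0 : 0 < y := by linarith
  have hs := s₀_lt_one hx hy
  have key : ∫ θ in Ioo (-π) π, ∫ t in Ioi Y, Complex.exp ((contour x y θ - 1) * t) *
      (Complex.exp (-Y * contour x y θ) * weight x y μ X Y θ) =
      Complex.exp (-Y) * ∫ θ in Ioo (-π) π, weight x y μ X Y θ / (1 - contour x y θ) := by
    rw [← integral_const_mul]
    refine setIntegral_congr_fun measurableSet_Ioo fun θ hθ => ?_
    have h1 : (contour x y θ - 1).re < 0 := by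
      have := contour_re_le (x := x) hy0 hθ
      simp only [Complex.sub_re, Complex.one_re]
      linarith
    have h2 : contour x y θ - 1 ≠ 0 := fun h => by simp [h] at h1
    have h3 : 1 - contour x y θ ≠ 0 := fun h => h2 (by rw [← neg_sub, h, neg_zero])
    have e : Complex.exp ((contour x y θ - 1) * Y) * Complex.exp (-Y * contour x y θ) =
        Complex.exp (-Y) := by
      rw [← Complex.exp_add]; ring_nf
    rw [integral_mul_const, integral_exp_mul_complex_Ioi h1, ← e]
    field_simp
    ring
  rw [Q, ← integral_complex_ofReal, setIntegral_congr_fun measurableSet_Ioi fun t (ht : t ∈ Ioi Y) =>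
    integrand_eq_integral_exp (x := x) (y := y) (Y := Y) hy0 hμ hX (hY.trans (mem_Ioi.1 ht)),
    integral_const_mul, integral_integral_swap (integrable_exp_mul_weight hx hy hμ hX hY), key,
    sub_eq_add_neg, Complex.exp_add]
  ring

lemma integrableOn_weight_div (hx : 0 ≤ x) (hy : x + 1 < y) (hμ : 0 < μ) (hX : 0 ≤ X)
    (hY : 0 < Y) :
    IntegrableOn (fun θ => weight x y μ X Y θ / (1 - contour x y θ)) (Ioo (-π) π) := by
  have hy0 : 0 < y := by linarith
  have hs := s₀_lt_one hx hy
  simp_rw [div_eq_mul_inv]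
  refine Integrable.mul_bdd (c := (1 - s₀ x y)⁻¹) (integrableOn_weight hy0 hμ hX hY) ?_ ?_
  · have h1 : Measurable (contour x y) := measurable_contour
    exact Measurable.aestronglyMeasurable (by fun_prop)
  · filter_upwards [ae_restrict_mem measurableSet_Ioo] with θ hθ
    rw [norm_inv]
    refine inv_anti₀ (by linarith) ?_
    refine le_trans ?_ (Complex.re_le_norm _)
    have := contour_re_le (x := x) hy0 hθ
    simp only [Complex.sub_re, Complex.one_re]
    linarith

end Fubini

/-! ### The phase on the contour and the real form of the representation -/

section Phase

variable {x y : ℝ}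

/-- The phase function is real on the contour. -/
lemma phi_contour (hx : 0 ≤ x) (hy : 0 < y) {θ : ℝ} (hθ : θ ∈ Ioo (-π) π) :
    phi x y (contour x y θ) =
      ((cos θ * rho θ (xi x y) - Real.log (r x y θ) : ℝ) : ℂ) := by
  have hr := r_pos (x := x) hy hθ
  have h1 := mul_r_sub_div_r hx hy hθ
  have h2 := mul_r_add_div_r hx hy hθ
  have h3 := sin_mul_tau hθ
  have hr' : (r x y θ : ℂ) ≠ 0 := Complex.ofReal_ne_zero.2 hr.ne'
  rw [phi, contour, log_polar hθ hr, polar]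
  have e : (x : ℂ) / (r x y θ * Complex.exp (θ * Complex.I)) =
      (x / r x y θ : ℝ) * Complex.exp ((-θ : ℝ) * Complex.I) := by
    push_cast
    rw [neg_mul, Complex.exp_neg]
    field_simp
  rw [e]
  apply Complex.ext
  · simp only [Complex.add_re, Complex.sub_re, Complex.re_ofReal_mul,
      Complex.exp_ofReal_mul_I_re, Complex.ofReal_re, Complex.I_re, cos_neg, ← h2]
    ring
  -- The imaginary part is `sin θ (y r - x/r) - θ = sin θ * tau θ - θ = 0`.
  · simp only [Complex.add_im, Complex.sub_im, Complex.im_ofReal_mul,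
      Complex.exp_ofReal_mul_I_im, Complex.ofReal_im, Complex.I_im, sin_neg]
    rw [← h1] at h3
    linear_combination h3

lemma contour_zero : contour x y 0 = s₀ x y := by
  simp [contour, polar, r_zero]

lemma phi_s₀ (hx : 0 ≤ x) (hy : 0 < y) :
    phi x y (s₀ x y) = ((√(1 + xi x y ^ 2) - Real.log (s₀ x y) : ℝ) : ℂ) := by
  have := phi_contour hx hy (θ := 0) ⟨by linarith [pi_pos], pi_pos⟩
  rw [contour_zero, r_zero] at this
  simpa [rho, tau_zero] using this

lemma hasDerivAt_phi_s₀ (hx : 0 ≤ x) (hy : 0 < y) : HasDerivAt (phi x y) 0 (s₀ x y : ℂ) := by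
  have hs := s₀_pos (x := x) hy
  have hs' : (s₀ x y : ℂ) ≠ 0 := Complex.ofReal_ne_zero.2 hs.ne'
  have h1 := ((hasDerivAt_inv hs').const_mul (x : ℂ)).add
    ((hasDerivAt_id (s₀ x y : ℂ)).const_mul (y : ℂ))
  have h2 := h1.sub (Complex.hasDerivAt_log (Or.inl (by simpa using hs)))
  have h3 : y * s₀ x y ^ 2 = s₀ x y + x := by
    have := s₀_quadratic hx hy
    field_simp at this
    linarith
  have h3' : (y : ℂ) * (s₀ x y : ℂ) ^ 2 = s₀ x y + x := by exact_mod_cast h3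
  refine (h2.congr_deriv ?_).congr_of_eventuallyEq (Eventually.of_forall fun s => ?_)
  · field_simp
    linear_combination h3'
  · simp [phi, div_eq_mul_inv]

/-- This says `φ(s₀) ≤ φ(1)`, which makes `ζ` real. By `log(1/s₀) ≤ 1/s₀ - 1`, the difference is at
most `(1-s₀)(x+1-ys₀)/s₀`, and `y s₀ = 1 + x/s₀ ≥ 1 + x`. -/
lemma phi_s₀_le (hx : 0 ≤ x) (hy : x + 1 < y) :
    √(1 + xi x y ^ 2) - Real.log (s₀ x y) ≤ x + y := by
  have hy0 : 0 < y := by linarith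
  have hs := s₀_pos (x := x) hy0
  have h1 := mul_r_add_div_r hx hy0 (θ := 0) ⟨by linarith [pi_pos], pi_pos⟩
  rw [r_zero, rho, tau_zero, one_pow] at h1
  have h2 := s₀_quadratic hx hy0
  have h3 := s₀_lt_one hx hy
  have h4 := Real.log_le_sub_one_of_pos (inv_pos.2 hs)
  rw [Real.log_inv] at h4
  rw [← h1]
  have h5 : x ≤ x / s₀ x y := le_div_self hx hs h3.le
  have h6 : y * s₀ x y - (x + 1) ≥ 0 := by linarith
  have h7 : (1 - s₀ x y) * (x + 1 - y * s₀ x y) / s₀ x y ≤ 0 :=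
    div_nonpos_of_nonpos_of_nonneg (by nlinarith) hs.le
  have h8 : (1 - s₀ x y) * (x + 1 - y * s₀ x y) / s₀ x y =
      x / s₀ x y + y * s₀ x y - x - y + (s₀ x y)⁻¹ - 1 := by field_simp; ring
  linarith

/-- `ψ(θ)` is `φ` at the contour point minus `φ(s₀)`. -/
lemma psi_eq (hy : 0 < y) {θ : ℝ} (hθ : θ ∈ Ioo (-π) π) :
    psi x y θ = (cos θ * rho θ (xi x y) - Real.log (r x y θ)) -
      (√(1 + xi x y ^ 2) - Real.log (s₀ x y)) := by
  have hr := r_pos (x := x) hy hθ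
  have hs := s₀_pos (x := x) hy
  have e : (tau θ + rho θ (xi x y)) / (1 + √(1 + xi x y ^ 2)) = r x y θ / s₀ x y := by
    unfold r s₀; field_simp
  rw [psi, e, Real.log_div hr.ne' hs.ne']
  ring

lemma f_eq_re (hx : 0 ≤ x) (hy : x + 1 < y) {θ : ℝ} (hθ : θ ∈ Ioo (-π) π) :
    f x y θ = (contourDeriv x y θ / (1 - contour x y θ) / Complex.I).re := by
  have hy0 : 0 < y := by linarith
  have h1 : 0 < (1 - contour x y θ).re := by
    have := contour_re_le (x := x) hy0 hθ
    have := s₀_lt_one hx hy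
    simp only [Complex.sub_re, Complex.one_re]
    linarith
  have hsc := sin_sq_add_cos_sq θ
  have hN : Complex.normSq (1 - contour x y θ) = r x y θ ^ 2 - 2 * r x y θ * cos θ + 1 := by
    rw [Complex.normSq_apply]
    simp only [contour, polar, Complex.sub_re, Complex.sub_im, Complex.one_re, Complex.one_im,
      Complex.re_ofReal_mul, Complex.im_ofReal_mul, Complex.exp_ofReal_mul_I_re,
      Complex.exp_ofReal_mul_I_im]
    linear_combination (r x y θ ^ 2) * hsc
  rw [f, (hasDerivAt_r hθ).deriv, ← hN, Complex.div_I, Complex.neg_re, Complex.mul_I_re, neg_neg,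
    Complex.div_im, ← sub_div]
  congr 1
  simp only [contour, contourDeriv, polar, polarDeriv, Complex.sub_re, Complex.sub_im,
    Complex.one_re, Complex.one_im, Complex.mul_re, Complex.mul_im, Complex.add_re, Complex.add_im, Complex.ofReal_re, Complex.ofReal_im,
    Complex.I_re, Complex.I_im, Complex.exp_ofReal_mul_I_re, Complex.exp_ofReal_mul_I_im]
  linear_combination (r x y θ ^ 2) * hsc

lemma weight_eq (hx : 0 ≤ x) (hy : 0 < y) (μ : ℝ) {θ : ℝ} (hθ : θ ∈ Ioo (-π) π) :
    weight x y μ (μ * x) (μ * y) θ =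
      (Real.exp (μ * (cos θ * rho θ (xi x y) - Real.log (r x y θ))) : ℝ) * contourDeriv x y θ := by
  have h := phi_contour hx hy hθ
  rw [weight, Complex.ofReal_exp, Complex.ofReal_mul μ (cos θ * _ - _), ← h, phi,
    Complex.cpow_def_of_ne_zero (contour_ne_zero hy hθ), ← mul_assoc, ← mul_assoc,
    ← Complex.exp_add, ← Complex.exp_add]
  congr 2
  push_cast
  ring

/-- The integrand of the final representation is the real part of the contour integrand. -/
lemma exp_mul_f_eq_re (hx : 0 ≤ x) (hy : x + 1 < y) (μ : ℝ) {θ : ℝ} (hθ : θ ∈ Ioo (-π) π) :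
    Real.exp (μ * psi x y θ) * f x y θ =
      Real.exp (-(μ * (√(1 + xi x y ^ 2) - Real.log (s₀ x y)))) *
        (weight x y μ (μ * x) (μ * y) θ / (1 - contour x y θ) / Complex.I).re := by
  have hy0 : 0 < y := by linarith
  rw [weight_eq hx hy0 μ hθ, mul_div_assoc, mul_div_assoc, Complex.re_ofReal_mul,
    ← f_eq_re hx hy hθ, psi_eq hy0 hθ, mul_sub, sub_eq_add_neg, Real.exp_add]
  ring

lemma integrableOn_exp_mul_f (hx : 0 ≤ x) (hy : x + 1 < y) {μ : ℝ} (hμ : 0 < μ) :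
    IntegrableOn (fun θ => Real.exp (μ * psi x y θ) * f x y θ) (Ioo (-π) π) := by
  have hy0 : 0 < y := by linarith
  have h := integrableOn_weight_div hx hy hμ (X := μ * x) (Y := μ * y) (by positivity)
    (by positivity)
  exact IntegrableOn.congr_fun ((h.div_const Complex.I).re.const_mul _)
    (fun θ hθ => (exp_mul_f_eq_re hx hy μ hθ).symm) measurableSet_Ioo

lemma Q_eq (hx : 0 ≤ x) (hy : x + 1 < y) {μ : ℝ} (hμ : 0 < μ) :
    Q μ (μ * x) (μ * y) =
      Real.exp (μ * (-x - y + (√(1 + xi x y ^ 2) - Real.log (s₀ x y)))) / (2 * π) *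
        ∫ θ in Ioo (-π) π, Real.exp (μ * psi x y θ) * f x y θ := by
  have hy0 : 0 < y := by linarith
  have hX : 0 ≤ μ * x := by positivity
  have hY : 0 < μ * y := by positivity
  have hW := (integrableOn_weight_div hx hy hμ hX hY).div_const Complex.I
  rw [setIntegral_congr_fun measurableSet_Ioo fun θ hθ => exp_mul_f_eq_re hx hy μ hθ,
    integral_const_mul]
  -- `Q` is real, so the complex representation may be replaced by its real part.
  have hre := integral_re hW
  simp only [RCLike.re_to_complex] at hre
  have h := congrArg Complex.re (Q_eq_integral hx hy hμ hX hY)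
  rw [Complex.ofReal_re] at h
  rw [hre, h, integral_div, ← Complex.re_ofReal_mul, ← Complex.re_ofReal_mul]
  congr 1
  rw [show μ * (-x - y + (√(1 + xi x y ^ 2) - Real.log (s₀ x y))) =
    (-(μ * x) - μ * y) + μ * (√(1 + xi x y ^ 2) - Real.log (s₀ x y)) by ring, Real.exp_add,
    Real.exp_neg (μ * (√(1 + xi x y ^ 2) - Real.log (s₀ x y)))]
  have hE : Complex.exp (μ * (√(1 + xi x y ^ 2) - Real.log (s₀ x y) : ℝ)) ≠ 0 :=
    Complex.exp_ne_zero _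
  push_cast at hE ⊢
  field_simp

end Phase

end Marcum

theorem mainTheorem1 (μ x y : ℝ) (hμ : 0 < μ) (hx : 0 ≤ x) (hy : x + 1 < y) :
    -- `s₀` is a saddle point of `φ` in `(0, 1)`
    (0 < Marcum.s₀ x y ∧ Marcum.s₀ x y < 1 ∧
      HasDerivAt (Marcum.phi x y) 0 (Marcum.s₀ x y : ℂ)) ∧
    -- the contour `s = r(θ) e^{iθ}` passes through `s₀`, and `φ` is real on it
    Marcum.r x y 0 = Marcum.s₀ x y ∧
    (∀ θ ∈ Set.Ioo (-Real.pi) Real.pi, 0 < Marcum.r x y θ ∧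
      Marcum.phi x y (Marcum.r x y θ * Complex.exp (θ * Complex.I)) =
        ((Real.cos θ * Marcum.rho θ (Marcum.xi x y) - Real.log (Marcum.r x y θ) : ℝ) : ℂ)) ∧
    -- `r` is differentiable, with an explicit derivative, and `f` is even
    (∀ θ ∈ Set.Ioo (-Real.pi) Real.pi, DifferentiableAt ℝ (Marcum.r x y) θ ∧
      (θ ≠ 0 → deriv (Marcum.r x y) θ =
        (Real.sin θ - θ * Real.cos θ) / (2 * y * Real.sin θ ^ 2) *
          (1 + θ / (Marcum.rho θ (Marcum.xi x y) * Real.sin θ))) ∧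
      Marcum.f x y (-θ) = Marcum.f x y θ) ∧
    -- both integrals in the representation converge absolutely
    MeasureTheory.IntegrableOn (Marcum.integrand μ (μ * x)) (Set.Ioi (μ * y)) ∧
    IntervalIntegrable (fun θ => Real.exp (μ * Marcum.psi x y θ) * Marcum.f x y θ)
      MeasureTheory.volume (-Real.pi) Real.pi ∧
    -- `ζ` exists, and the representation holds for each choice of its sign
    (∃ ζ : ℝ, -(x : ℂ) - y + Marcum.phi x y (Marcum.s₀ x y) = -(1 / 2) * (ζ : ℂ) ^ 2) ∧
    (∀ ζ : ℝ, -(x : ℂ) - y + Marcum.phi x y (Marcum.s₀ x y) = -(1 / 2) * (ζ : ℂ) ^ 2 →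
      Marcum.Q μ (μ * x) (μ * y) =
        Real.exp (-(1 / 2) * μ * ζ ^ 2) / (2 * Real.pi) *
          ∫ θ in (-Real.pi)..Real.pi, Real.exp (μ * Marcum.psi x y θ) * Marcum.f x y θ) := by
  have hy0 : 0 < y := by linarith
  have hπ : -π ≤ π := by linarith [pi_pos]
  have hzeta : ∀ ζ : ℝ, -(x : ℂ) - y + Marcum.phi x y (Marcum.s₀ x y) = -(1 / 2) * (ζ : ℂ) ^ 2 ↔
      -x - y + (√(1 + Marcum.xi x y ^ 2) - Real.log (Marcum.s₀ x y)) = -(1 / 2) * ζ ^ 2 := by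
    intro ζ
    rw [Marcum.phi_s₀ hx hy0]
    norm_cast
    rw [← Complex.ofReal_inj]
    push_cast
    rfl
  refine ⟨⟨Marcum.s₀_pos hy0, Marcum.s₀_lt_one hx hy, Marcum.hasDerivAt_phi_s₀ hx hy0⟩,
    Marcum.r_zero, fun θ hθ => ⟨Marcum.r_pos hy0 hθ, Marcum.phi_contour hx hy0 hθ⟩,
    fun θ hθ => ⟨(Marcum.hasDerivAt_r hθ).differentiableAt, fun h0 => ?_, Marcum.f_neg θ⟩,
    Marcum.integrableOn_integrand hx hy hμ (by positivity) (by positivity),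
    (intervalIntegrable_iff_integrableOn_Ioo_of_le hπ).2 (Marcum.integrableOn_exp_mul_f hx hy hμ),
    ?_, fun ζ hζ => ?_⟩
  · have hs := Marcum.sin_ne_zero_of_mem_Ioo hθ h0
    have hr := Marcum.rho_pos hθ (Marcum.xi x y)
    rw [(Marcum.hasDerivAt_r hθ).deriv, Marcum.dr, Marcum.dtau, Marcum.tau_of_ne h0]
    field_simp
  · refine ⟨√(2 * (x + y - (√(1 + Marcum.xi x y ^ 2) - Real.log (Marcum.s₀ x y)))), ?_⟩
    rw [hzeta, sq_sqrt (by linarith [Marcum.phi_s₀_le hx hy])]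
    ring
  · rw [Marcum.Q_eq hx hy hμ, (hzeta ζ).1 hζ, intervalIntegral.integral_of_le hπ,
      integral_Ioc_eq_integral_Ioo]
    congr 3
    ring
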